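/- All graphs are finite, undirected and loopless, with nonnegative rational edge weights $w$ encoded in binary. **Fair densest subgraph.** Let $G=(V,E,w)$ be a graph whose vertices are coloured red or blue. A set $S\subseteq V$ is *fair* if it contains as many red as blue vertices, and $G$ is *fair* if $V$ is fair. The density of a nonempty set $S\subseteq V$ is the average weighted degree of the induced subgraph, $D_S = 2\,w(E\cap (S\times S))/|S|$, where each undirected edge is counted once. For $\alpha\ge 1$, computing an $\alpha$-approximation of the fair densest subgraph problem means: given a graph $G$, find a nonempty fair set $S$ with $\alpha\cdot D_S\ge D_T$ for every nonempty fair set $T\subseteq V$. **Small set expansion.** In a nonempty graph that is $d$-regular (all weighted degrees equal $d>0$), the expansion of a nonempty set $S\subseteq V$ is $\Phi(S)=w(E(S,V\setminus S))/(d|S|)$. For constants $\eta,\delta\in(0,1)$, the problem $SSE(\eta,\delta)$ asks, given such a graph, to distinguish the case that some $S\subseteq V$ with $|S|=\delta |V|$ has $\Phi(S)\le\eta$ from the case that every $S\subseteq V$ with $|S|=\delta|V|$ has $\Phi(S)\ge 1-\eta$. The *Small Set Expansion Hypothesis* (SSEH) states that for every $\eta\in(0,1)$ there is a $\delta\in(0,1)$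 such that $SSE(\eta,\delta)$ is NP-hard. Here a (search or promise) problem is called NP-hard if for every language $L$ in NP there are polynomial-time computable functions $f,g$ such that, for every $x$, $f(x)$ is an admissible instance of the problem (one that has a correct answer) and, for every correct answer $y$ to $f(x)$, $g(x,y)$ tells whether $x\in L$. **Theorem.** If SSEH holds, then for every $0<\varepsilon\le 1$, computing a $(2-\varepsilon)$-approximation of the fair densest subgraph problem, restricted to fair graphs, is NP-hard. -/

import Mathlib

namespace FairDensest

/-! ### Machine model and step count -/

/-- The tape alphabet: the two bits and a separator. -/
inductive Sym : Type
  | zero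
  | one
  | sep
  deriving DecidableEq

abbrev Word : Type := List Sym

/-- The memory: registers numbered by `ℕ`, each holding a word that is accessed as a stack
(the head of the list is the top). A program mentions only finitely many registers, so that this is
a machine with a fixed finite number of stacks over a fixed finite alphabet (two stacks make up one
tape of a Turing machine). -/
abbrev Store : Type := ℕ → Word

/-- Programs of the stack machine. A test looks at the top symbol of one register only
(`none` if the register is empty). -/
inductive Prog : Type
  | skip : Prog
  | push (r : ℕ) (a : Sym) : Prog
  | pop (r : ℕ) : Prog
  | seq (p q : Prog) : Prog
  | ite (r : ℕ) (test : Option Sym → Bool) (p q : Prog) : Prog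
  | loop (r : ℕ) (test : Option Sym → Bool) (p : Prog) : Prog

/-- `Exec p σ τ t`: started in memory `σ`, the program `p` halts in memory `τ` after exactly `t`
elementary steps. Each push, pop, skip and each evaluation of a test is one step; `loop r test p`
repeats `p` as long as the test succeeds. -/
inductive Exec : Prog → Store → Store → ℕ → Prop
  | skip (σ : Store) : Exec Prog.skip σ σ 1
  | push (σ : Store) (r : ℕ) (a : Sym) :
      Exec (Prog.push r a) σ (Function.update σ r (a :: σ r)) 1
  | pop (σ : Store) (r : ℕ) :
      Exec (Prog.pop r) σ (Function.update σ r (σ r).tail) 1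
  | seq {p q : Prog} {σ τ υ : Store} {s t : ℕ} :
      Exec p σ τ s → Exec q τ υ t → Exec (Prog.seq p q) σ υ (s + t)
  | ite_true {r : ℕ} {test : Option Sym → Bool} {p q : Prog} {σ τ : Store} {t : ℕ} :
      test (σ r).head? = true → Exec p σ τ t → Exec (Prog.ite r test p q) σ τ (t + 1)
  | ite_false {r : ℕ} {test : Option Sym → Bool} {p q : Prog} {σ τ : Store} {t : ℕ} :
      test (σ r).head? = false → Exec q σ τ t → Exec (Prog.ite r test p q) σ τ (t + 1)
  | loop_true {r : ℕ} {test : Option Sym → Bool} {p : Prog} {σ τ υ : Store} {s t : ℕ} :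
      test (σ r).head? = true → Exec p σ τ s → Exec (Prog.loop r test p) τ υ t →
        Exec (Prog.loop r test p) σ υ (s + t + 1)
  | loop_false {r : ℕ} {test : Option Sym → Bool} {p : Prog} {σ : Store} :
      test (σ r).head? = false → Exec (Prog.loop r test p) σ σ 1

/-- The initial memory: the inputs are in registers `0, 1, …`, all other registers are empty. -/
def initStore (inputs : List Word) : Store := fun r => inputs.getD r []

/-- `f` is computable in time polynomial in the length of its input; the output is read from
register `0`. -/
def PolyTime (f : Word → Word) : Prop :=
  ∃ (p : Prog) (T : Polynomial ℕ), ∀ x : Word, ∃ (τ : Store) (t : ℕ),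
    Exec p (initStore [x]) τ t ∧ τ 0 = f x ∧ t ≤ T.eval x.length

/-- The same for a function of two words. -/
def PolyTime₂ (f : Word → Word → Word) : Prop :=
  ∃ (p : Prog) (T : Polynomial ℕ), ∀ x y : Word, ∃ (τ : Store) (t : ℕ),
    Exec p (initStore [x, y]) τ t ∧ τ 0 = f x y ∧ t ≤ T.eval (x.length + y.length)

/-! ### NP and NP-hardness -/

/-- The output words for "yes" and "no". -/
def yes : Word := [Sym.one]
def no : Word := [Sym.zero]

/-- The class NP: membership has certificates of polynomial length that are verified in polynomial
time. -/
def InNP (L : Set Word) : Prop :=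
  ∃ (V : Word → Word → Word) (q : Polynomial ℕ), PolyTime₂ V ∧
    ∀ x : Word, x ∈ L ↔ ∃ y : Word, y.length ≤ q.eval x.length ∧ V x y = yes

/-- A computational problem is given by the relation `R I y`: "`I` is an admissible instance and
`y` is a correct answer to it". (For a promise problem, the instances outside the promise have no
correct answer.)

The problem is NP-hard if every language in NP reduces to it in polynomial time: from `x` one
computes an admissible instance `f x`, and from `x` and *any* correct answer to `f x` one computes
whether `x` belongs to the language. -/
def NPHard (R : Word → Word → Prop) : Prop :=
  ∀ L : Set Word, InNP L → ∃ (f : Word → Word) (g : Word → Word → Word),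
    PolyTime f ∧ PolyTime₂ g ∧
      ∀ x : Word, (∃ y, R (f x) y) ∧ ∀ y, R (f x) y → (g x y = yes ↔ x ∈ L)

/-! ### Weighted graphs -/

/-- A finite undirected loopless graph with vertices `0, …, n - 1` and nonnegative rational edge
weights, written with a common denominator. Weight `0` stands for a missing edge. -/
structure WGraph where
  n : ℕ
  num : Fin n → Fin n → ℕ
  den : ℕ
  den_pos : 0 < den
  symm : ∀ u v, num u v = num v u
  loopless : ∀ u, num u u = 0

namespace WGraph

noncomputable def weight (G : WGraph) (u v : Fin G.n) : ℝ := (G.num u v : ℝ) / (G.den : ℝ)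

/-- Every vertex has weighted degree `d`. -/
def IsRegular (G : WGraph) (d : ℝ) : Prop := ∀ u, ∑ v, G.weight u v = d

/-- The expansion of `S` in a `d`-regular graph: the weight of the edges that leave `S`, divided by
the sum `d * |S|` of the degrees in `S`. -/
noncomputable def expansion (G : WGraph) (d : ℝ) (S : Finset (Fin G.n)) : ℝ :=
  (∑ u ∈ S, ∑ v ∈ Sᶜ, G.weight u v) / (d * (S.card : ℝ))

/-- The density of `S`: the average weighted degree of the subgraph induced by `S`, which is twice
the total weight of its edges divided by `|S|` (the double sum counts each edge twice). -/
noncomputable def density (G : WGraph) (S : Finset (Fin G.n)) : ℝ :=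
  (∑ u ∈ S, ∑ v ∈ S, G.weight u v) / (S.card : ℝ)

/-- A set is fair, for the colouring `red` (`true` is red, `false` is blue), if it has as many red
as blue vertices. -/
def FairSet (G : WGraph) (red : Fin G.n → Bool) (S : Finset (Fin G.n)) : Prop :=
  (S.filter fun v => red v = true).card = (S.filter fun v => red v = false).card

end WGraph

/-! ### Encodings as words -/

def bit (b : Bool) : Sym := if b then Sym.one else Sym.zero

/-- A natural number in binary (least significant bit first), closed by a separator. -/
def encodeNat (k : ℕ) : Word := (Nat.bits k).map bit ++ [Sym.sep]

/-- The denominator followed by the `n * n` entries of the weight matrix, row by row. -/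
def encodeWeights (G : WGraph) : Word :=
  encodeNat G.den ++
    (List.ofFn fun u => (List.ofFn fun v => encodeNat (G.num u v)).flatten).flatten

/-- A graph: a list of its vertices (each written `1`), then its weights. -/
def encodeGraph (G : WGraph) : Word :=
  List.replicate G.n Sym.one ++ [Sym.sep] ++ encodeWeights G

/-- A coloured graph: the list of the colours of its vertices, then its weights. -/
def encodeColored (G : WGraph) (red : Fin G.n → Bool) : Word :=
  (List.ofFn fun v => bit (red v)) ++ [Sym.sep] ++ encodeWeights G

/-- A set of vertices, as its indicator vector. -/
def encodeSet (G : WGraph) (S : Finset (Fin G.n)) : Word :=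
  List.ofFn fun v => bit (decide (v ∈ S))

/-! ### The two problems -/

/-- The small set expansion problem: for a nonempty regular weighted graph of positive degree,
distinguish the case that some set of exactly `δ * |V|` vertices has expansion at most `η` from the
case that all these sets have expansion at least `1 - η`. -/
def SSE (η δ : ℝ) (I y : Word) : Prop :=
  ∃ (G : WGraph) (d : ℝ), I = encodeGraph G ∧ 0 < G.n ∧ 0 < d ∧ G.IsRegular d ∧
    ((y = yes ∧ ∃ S : Finset (Fin G.n), (S.card : ℝ) = δ * (G.n : ℝ) ∧ G.expansion d S ≤ η) ∨
      (y = no ∧ ∀ S : Finset (Fin G.n), (S.card : ℝ) = δ * (G.n : ℝ) → 1 - η ≤ G.expansion d S))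

/-- The small set expansion hypothesis. -/
def SSEH : Prop :=
  ∀ η : ℝ, 0 < η → η < 1 → ∃ δ : ℝ, 0 < δ ∧ δ < 1 ∧ NPHard (SSE η δ)

/-- Computing an `α`-approximation of the fair densest subgraph in fair graphs: the instance is a
two-coloured graph whose vertex set is fair, and a correct answer is a nonempty fair set whose
density is at least the fraction `1 / α` of the density of every nonempty fair set. -/
def FairDensestApprox (α : ℝ) (I y : Word) : Prop :=
  ∃ (G : WGraph) (red : Fin G.n → Bool) (S : Finset (Fin G.n)),
    I = encodeColored G red ∧ G.FairSet red Finset.univ ∧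
    y = encodeSet G S ∧ S.Nonempty ∧ G.FairSet red S ∧
    ∀ T : Finset (Fin G.n), T.Nonempty → G.FairSet red T → G.density T ≤ α * G.density S

end FairDensest

/-! The reduction starts from small set expansion with η = 1/N, where N > 5/ε. Let G be d-regular on
n vertices, let k = δn, and let D be the degree of G after clearing denominators. The new graph
consists of G, coloured blue, and n red vertices: k of them form a clique and the others are
isolated. The weights are scaled so that all vertices of G and of the clique have the same degree M
= (k - 1)D (`WGraph.out`). Approximation is invariant under scaling, so the denominator of G can be
dropped.

If some k-set S has expansion at most η, it keeps at least the fraction 1 - η of its degrees inside,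
and S together with the clique is a fair set of density at least (1 - η/2)M
(`exists_density_out_ge`). Now suppose that all k-sets have expansion at least 1 - η. A fair set has
m blue and m red vertices, at most min(m, k) of the latter in the clique. If m is far from k, the
clique part adds little to the blue part, whose weight is at most mM; if m is close to k, the blue
part is sparse and only the red half is dense. Either way the density is at most (1 + 2η)M/2
(`inner_add_clique_le`, `inner_out_le`). Sparsity passes from k-sets to smaller sets by monotonicity
and to larger ones by deleting vertices of low degree (`inner_le_of_card_ge`).

Since (2 - ε)(1 + 2η) < 2 - η, the density of any (2 - ε)-approximate solution exceeds (1 + 2η)M/2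
in the first case and not in the second (`isDense_of_expansion_le`,
`isDense_eq_false_of_le_expansion`), so it tells which answer is correct for the expansion instance.

The rest shows that the reduction runs in polynomial time. The class `PT` is closed under
composition, pairing, case distinction and size-bounded recursion (`PT.comp`, `PT.pair`, `PT.ite`,
`PT.foldl`), and the reduction is assembled from these. Indices and cardinalities are in unary,
weights in binary. The real δ need not be computed: it is fixed, and if it is a fraction, that
fraction is built into the program (`exists_pT_size`). -/

namespace FairDensest

/-! ### Elementary facts on the stack machine -/

theorem polynomial_eval_mono (T : Polynomial ℕ) {m n : ℕ} (h : m ≤ n) : T.eval m ≤ T.eval n := by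
  rw [Polynomial.eval_eq_sum_range, Polynomial.eval_eq_sum_range]
  gcongr

/-- `p` leads from `σ` to `τ` in at most `b` steps. -/
def Runs (p : Prog) (σ τ : Store) (b : ℕ) : Prop := ∃ t ≤ b, Exec p σ τ t

theorem Runs.mono {p : Prog} {σ τ : Store} {a b : ℕ} (h : Runs p σ τ a) (hab : a ≤ b) :
    Runs p σ τ b :=
  let ⟨t, ht, e⟩ := h
  ⟨t, ht.trans hab, e⟩

theorem Runs.seq {p q : Prog} {σ τ υ : Store} {a b : ℕ} (hp : Runs p σ τ a) (hq : Runs q τ υ b) :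
    Runs (Prog.seq p q) σ υ (a + b) :=
  let ⟨s, hs, e⟩ := hp
  let ⟨t, ht, e₂⟩ := hq
  ⟨s + t, Nat.add_le_add hs ht, Exec.seq e e₂⟩

/-- Renaming of the registers of a program. -/
def Prog.rename (ρ : ℕ → ℕ) : Prog → Prog
  | Prog.skip => Prog.skip
  | Prog.push r a => Prog.push (ρ r) a
  | Prog.pop r => Prog.pop (ρ r)
  | Prog.seq p q => Prog.seq (p.rename ρ) (q.rename ρ)
  | Prog.ite r test p q => Prog.ite (ρ r) test (p.rename ρ) (q.rename ρ)
  | Prog.loop r test p => Prog.loop (ρ r) test (p.rename ρ)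

/-- Injectivity keeps distinct registers from colliding, so the renamed run copies the original step
by step. The last clause is a frame property: it is what allows a program to be used as a
subroutine. -/
theorem Exec.rename {ρ : ℕ → ℕ} (hρ : Function.Injective ρ) {p : Prog} {σ τ : Store} {t : ℕ}
    (h : Exec p σ τ t) : ∀ σ' : Store, (∀ i, σ' (ρ i) = σ i) →
      ∃ τ' : Store, Exec (p.rename ρ) σ' τ' t ∧ (∀ i, τ' (ρ i) = τ i) ∧
        ∀ j, j ∉ Set.range ρ → τ' j = σ' j := by
  have key : ∀ (σ σ' : Store) (r : ℕ) (w w' : Word), (∀ i, σ' (ρ i) = σ i) → w = w' →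
      (∀ i, Function.update σ' (ρ r) w' (ρ i) = Function.update σ r w i) ∧
        ∀ j, j ∉ Set.range ρ → Function.update σ' (ρ r) w' j = σ' j := by
    intro σ σ' r w w' hσ hw
    subst hw
    refine ⟨fun i => ?_, fun j hj => ?_⟩
    · by_cases hi : i = r
      · subst hi; simp
      · rw [Function.update_of_ne hi, Function.update_of_ne (fun h => hi (hρ h)), hσ]
    · rw [Function.update_of_ne]
      rintro rfl
      exact hj ⟨r, rfl⟩
  induction h with
  | skip σ => exact fun σ' hσ => ⟨σ', Exec.skip σ', hσ, fun _ _ => rfl⟩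
  | push σ r a =>
    intro σ' hσ
    have := key σ σ' r (a :: σ r) (a :: σ' (ρ r)) hσ (by rw [hσ])
    exact ⟨_, Exec.push σ' (ρ r) a, this⟩
  | pop σ r =>
    intro σ' hσ
    have := key σ σ' r (σ r).tail (σ' (ρ r)).tail hσ (by rw [hσ])
    exact ⟨_, Exec.pop σ' (ρ r), this⟩
  | seq _ _ ih₁ ih₂ =>
    intro σ' hσ
    obtain ⟨τ', e₁, h₁, f₁⟩ := ih₁ σ' hσ
    obtain ⟨υ', e₂, h₂, f₂⟩ := ih₂ τ' h₁
    exact ⟨υ', Exec.seq e₁ e₂, h₂, fun j hj => (f₂ j hj).trans (f₁ j hj)⟩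
  | ite_true ht _ ih =>
    intro σ' hσ
    obtain ⟨τ', e₁, h₁⟩ := ih σ' hσ
    exact ⟨τ', Exec.ite_true (by rw [hσ]; exact ht) e₁, h₁⟩
  | ite_false ht _ ih =>
    intro σ' hσ
    obtain ⟨τ', e₁, h₁⟩ := ih σ' hσ
    exact ⟨τ', Exec.ite_false (by rw [hσ]; exact ht) e₁, h₁⟩
  | loop_true ht _ _ ih₁ ih₂ =>
    intro σ' hσ
    obtain ⟨τ', e₁, h₁, f₁⟩ := ih₁ σ' hσ
    obtain ⟨υ', e₂, h₂, f₂⟩ := ih₂ τ' h₁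
    exact ⟨υ', Exec.loop_true (by rw [hσ]; exact ht) e₁ e₂, h₂,
      fun j hj => (f₂ j hj).trans (f₁ j hj)⟩
  | loop_false ht =>
    exact fun σ' hσ => ⟨σ', Exec.loop_false (by rw [hσ]; exact ht), hσ, fun _ _ => rfl⟩

/-- All registers that `p` mentions are below `p.width`. -/
def Prog.width : Prog → ℕ
  | Prog.skip => 0
  | Prog.push r _ => r + 1
  | Prog.pop r => r + 1
  | Prog.seq p q => max p.width q.width
  | Prog.ite _ _ p q => max p.width q.width
  | Prog.loop _ _ p => p.width

/-- `width` counts only registers that are pushed or popped. Registers that are merely tested may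
lie above it, since a test never writes. -/
theorem Exec.eq_of_width_le {p : Prog} {σ τ : Store} {t : ℕ} (h : Exec p σ τ t) :
    ∀ r, p.width ≤ r → τ r = σ r := by
  induction h with
  | skip σ => exact fun _ _ => rfl
  | push σ r a =>
    intro s hs
    exact Function.update_of_ne (by simp only [Prog.width] at hs; omega) _ _
  | pop σ r =>
    intro s hs
    exact Function.update_of_ne (by simp only [Prog.width] at hs; omega) _ _
  | seq _ _ ih₁ ih₂ =>
    intro r hr
    simp only [Prog.width, max_le_iff] at hr
    rw [ih₂ r hr.2, ih₁ r hr.1]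
  | ite_true _ _ ih =>
    intro r hr
    simp only [Prog.width, max_le_iff] at hr
    exact ih r hr.1
  | ite_false _ _ ih =>
    intro r hr
    simp only [Prog.width, max_le_iff] at hr
    exact ih r hr.2
  | loop_true _ _ _ ih₁ ih₂ =>
    intro r hr
    rw [ih₂ r hr, ih₁ r hr]
  | loop_false _ => exact fun _ _ => rfl

/-- A step pushes at most one symbol, so bounds on running time are also bounds on the size of
outputs and of leftover data. -/
theorem Exec.length_le {p : Prog} {σ τ : Store} {t : ℕ} (h : Exec p σ τ t) :
    ∀ r, (τ r).length ≤ (σ r).length + t := by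
  induction h with
  | skip σ => exact fun _ => by omega
  | push σ r a =>
    intro s
    by_cases hs : s = r
    · subst hs; simp
    · rw [Function.update_of_ne hs]; omega
  | pop σ r =>
    intro s
    by_cases hs : s = r
    · subst hs; simp; omega
    · rw [Function.update_of_ne hs]; omega
  | seq _ _ ih₁ ih₂ => intro r; have := ih₁ r; have := ih₂ r; omega
  | ite_true _ _ ih => intro r; have := ih r; omega
  | ite_false _ _ ih => intro r; have := ih r; omega
  | loop_true _ _ _ ih₁ ih₂ => intro r; have := ih₁ r; have := ih₂ r; omega
  | loop_false _ => exact fun _ => by omega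

/-! ### Stores given by a list of words -/

theorem update_initStore {L : List Word} {r : ℕ} (hr : r < L.length) (w : Word) :
    Function.update (initStore L) r w = initStore (L.set r w) := by
  funext j
  by_cases hj : j = r
  · subst hj
    simp [initStore, List.getD, hr]
  · rw [Function.update_of_ne hj]
    simp [initStore, List.getD, Ne.symm hj]

/-- Registers past the end of the list read as empty, so scratch registers can be added to the list
and dropped again when they are empty. -/
theorem initStore_append_nil (L : List Word) : initStore (L ++ [[]]) = initStore L := by
  funext j
  rcases lt_or_ge j L.length with h | h
  · simp [initStore, List.getD, List.getElem?_append_left h]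
  · simp only [initStore, List.getD, List.getElem?_append_right h, List.getElem?_eq_none h]
    rcases Nat.eq_zero_or_pos (j - L.length) with h' | h'
    · simp [h']
    · rw [List.getElem?_eq_none (by simp; omega)]

theorem Runs.push {L : List Word} {r : ℕ} (hr : r < L.length) (a : Sym) :
    Runs (Prog.push r a) (initStore L) (initStore (L.set r (a :: L.getD r []))) 1 :=
  ⟨1, le_rfl, by rw [← update_initStore hr]; exact Exec.push _ r a⟩

theorem Runs.pop {L : List Word} {r : ℕ} (hr : r < L.length) :
    Runs (Prog.pop r) (initStore L) (initStore (L.set r (L.getD r []).tail)) 1 :=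
  ⟨1, le_rfl, by rw [← update_initStore hr]; exact Exec.pop _ r⟩

/-- Register `0` becomes `r` and the others move above `m`. -/
def callMap (r m : ℕ) : ℕ → ℕ
  | 0 => r
  | j + 1 => m + j

/-- The program `p` with register `r` in place of register `0` and with its other registers moved
above `m`. -/
def Prog.callAt (p : Prog) (r m : ℕ) : Prog :=
  p.rename (callMap r m)

/-- The registers `1, 2, …` of `p` land at `m, m + 1, …`, which are empty because `L` has length
`m`. Hence `p` sees a fresh store with the content of register `r` as its input, and the frame
property protects the rest of `L`. -/
theorem Runs.callAt {p : Prog} {L : List Word} {r m b : ℕ} {y : Word} (hm : L.length = m)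
    (hr : r < m) (h : Runs p (initStore [L.getD r []]) (initStore [y]) b) :
    Runs (p.callAt r m) (initStore L) (initStore (L.set r y)) b := by
  subst hm
  obtain ⟨t, ht, e⟩ := h
  have hρ : Function.Injective (callMap r L.length) := by
    intro i j hij
    cases i <;> cases j <;> simp only [callMap] at hij <;> omega
  obtain ⟨τ', e₂, h₁, h₂⟩ := e.rename hρ (initStore L) (by
    intro i
    cases i with
    | zero => simp [initStore, callMap]
    | succ i => simp [initStore, callMap])
  have : τ' = initStore (L.set r y) := by
    funext j
    by_cases hj : j = r
    · subst hj
      have := h₁ 0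
      simp only [callMap] at this
      rw [this]
      simp [initStore, List.getD, hr]
    · rcases lt_or_ge j L.length with h | h
      · rw [h₂ j]
        · simp [initStore, List.getD, Ne.symm hj]
        · rintro ⟨i, hi⟩
          cases i <;> simp only [callMap] at hi <;> omega
      · have := h₁ (j - L.length + 1)
        simp only [callMap] at this
        rw [show L.length + (j - L.length) = j by omega] at this
        rw [this]
        simp [initStore, List.getD, h]
  exact ⟨t, ht, this ▸ e₂⟩

/-! ### Case distinction and loops -/

/-- Continue according to the top symbol of register `r`. -/
def Prog.caseTop (r : ℕ) (k : Option Sym → Prog) : Prog :=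
  Prog.ite r (fun o => decide (o = none)) (k none)
    (Prog.ite r (fun o => decide (o = some Sym.zero)) (k (some Sym.zero))
      (Prog.ite r (fun o => decide (o = some Sym.one)) (k (some Sym.one)) (k (some Sym.sep))))

theorem Runs.caseTop {r : ℕ} {k : Option Sym → Prog} {σ τ : Store} {b : ℕ}
    (h : Runs (k (σ r).head?) σ τ b) : Runs (Prog.caseTop r k) σ τ (b + 3) := by
  obtain ⟨t, ht, e⟩ := h
  match ho : (σ r).head? with
  | none =>
    rw [ho] at e
    exact ⟨t + 1, by omega, Exec.ite_true (by simp [ho]) e⟩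
  | some Sym.zero =>
    rw [ho] at e
    exact ⟨t + 1 + 1, by omega, Exec.ite_false (by simp [ho]) (Exec.ite_true (by simp [ho]) e)⟩
  | some Sym.one =>
    rw [ho] at e
    exact ⟨t + 1 + 1 + 1, by omega, Exec.ite_false (by simp [ho])
      (Exec.ite_false (by simp [ho]) (Exec.ite_true (by simp [ho]) e))⟩
  | some Sym.sep =>
    rw [ho] at e
    exact ⟨t + 1 + 1 + 1, by omega, Exec.ite_false (by simp [ho])
      (Exec.ite_false (by simp [ho]) (Exec.ite_false (by simp [ho]) e))⟩

/-- Run `body s` for the symbols `s` that are popped from register `r`, until it is empty. -/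
def Prog.forSym (r : ℕ) (body : Sym → Prog) : Prog :=
  Prog.loop r (fun o => decide (o ≠ none))
    (Prog.caseTop r fun o => Prog.seq (Prog.pop r) (o.elim Prog.skip body))

/-- Loop rule: `St w g` is the store with `w` still to be read and abstract state `g`. The invariant
restricts the cost bound `c` to reachable states. The overhead of 5 per round is the loop test, the
three tests of `caseTop` and the pop. -/
theorem Runs.forSym {γ : Type*} {r : ℕ} {body : Sym → Prog} {step : γ → Sym → γ}
    (St : Word → γ → Store) (hr : ∀ w g, St w g r = w)
    (hpop : ∀ s w g, Function.update (St (s :: w) g) r w = St w g)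
    (Inv : Word → γ → Prop) {c : ℕ}
    (hbody : ∀ s w g, Inv (s :: w) g →
      Runs (body s) (St w g) (St w (step g s)) c ∧ Inv w (step g s)) :
    ∀ w g, Inv w g →
      Runs (Prog.forSym r body) (St w g) (St [] (w.foldl step g)) ((c + 5) * w.length + 1) := by
  intro w
  induction w with
  | nil =>
    intro g _
    exact ⟨1, by simp, Exec.loop_false (by simp [hr])⟩
  | cons s w ih =>
    intro g hg
    obtain ⟨hb, hi⟩ := hbody s w g hg
    obtain ⟨t, ht, e⟩ := ih _ hi
    have h₁ : Runs (Prog.caseTop r fun o => Prog.seq (Prog.pop r) (o.elim Prog.skip body))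
        (St (s :: w) g) (St w (step g s)) (1 + c + 3) := by
      apply Runs.caseTop
      rw [hr]
      refine Runs.seq ⟨1, le_rfl, ?_⟩ hb
      have := Exec.pop (St (s :: w) g) r
      rwa [hr, List.tail_cons, hpop] at this
    obtain ⟨t₁, ht₁, e₁⟩ := h₁
    refine ⟨t₁ + t + 1, ?_, Exec.loop_true (by simp [hr]) e₁ e⟩
    simp only [List.length_cons]
    nlinarith

/-- Empty register `r`. -/
def Prog.clear (r : ℕ) : Prog := Prog.forSym r fun _ => Prog.skip

theorem Runs.clear (σ : Store) (r : ℕ) :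
    Runs (Prog.clear r) σ (Function.update σ r []) (6 * (σ r).length + 1) := by
  have := Runs.forSym (γ := Unit) (r := r) (body := fun _ => Prog.skip) (step := fun _ _ => ())
    (fun w _ => Function.update σ r w) (by simp) (by simp) (fun _ _ => True) (c := 1)
    (fun s w g _ => ⟨⟨1, le_rfl, Exec.skip _⟩, trivial⟩) (σ r) () trivial
  simpa [Prog.clear] using this

theorem Runs.clear_initStore {L : List Word} {r : ℕ} (hr : r < L.length) :
    Runs (Prog.clear r) (initStore L) (initStore (L.set r []))
      (6 * (L.getD r []).length + 1) := by
  rw [← update_initStore hr]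
  exact Runs.clear _ r

/-- Empty the registers `1, …, m`. -/
def Prog.clearUpTo : ℕ → Prog
  | 0 => Prog.skip
  | m + 1 => Prog.seq (Prog.clear (m + 1)) (Prog.clearUpTo m)

theorem Runs.clearUpTo (m : ℕ) : ∀ (σ : Store) (B : ℕ), (∀ r, 0 < r → (σ r).length ≤ B) →
    Runs (Prog.clearUpTo m) σ (fun r => if 0 < r ∧ r ≤ m then [] else σ r)
      ((6 * B + 1) * m + 1) := by
  induction m with
  | zero =>
    intro σ B _
    refine ⟨1, by simp, ?_⟩
    have : (fun r => if 0 < r ∧ r ≤ 0 then [] else σ r) = σ := by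
      funext r
      rw [if_neg (by omega)]
    rw [this]
    exact Exec.skip σ
  | succ m ih =>
    intro σ B hB
    have h₁ := Runs.clear σ (m + 1)
    have h₂ := ih (Function.update σ (m + 1) []) B (by
      intro r hr
      by_cases h : r = m + 1
      · subst h; simp
      · rw [Function.update_of_ne h]; exact hB r hr)
    have h₃ := h₁.seq h₂
    have : (fun r => if 0 < r ∧ r ≤ m then [] else Function.update σ (m + 1) [] r) =
        fun r => if 0 < r ∧ r ≤ m + 1 then [] else σ r := by
      funext r
      by_cases h : r = m + 1
      · subst h; simp
      · rw [Function.update_of_ne h]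
        by_cases h' : 0 < r ∧ r ≤ m
        · rw [if_pos h', if_pos (by omega)]
        · rw [if_neg h', if_neg (by omega)]
    rw [this] at h₃
    refine h₃.mono ?_
    have := hB (m + 1) (by omega)
    nlinarith

/-- Prepend a word to register `q`. -/
def Prog.pushWord (q : ℕ) : Word → Prog
  | [] => Prog.skip
  | a :: w => Prog.seq (Prog.pushWord q w) (Prog.push q a)

theorem Runs.pushWord {L : List Word} {q : ℕ} (hq : q < L.length) (w : Word) :
    Runs (Prog.pushWord q w) (initStore L) (initStore (L.set q (w ++ L.getD q [])))
      (w.length + 1) := by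
  induction w with
  | nil =>
    refine ⟨1, by simp, ?_⟩
    rw [List.nil_append, List.getD_eq_getElem _ _ hq, List.set_getElem_self]
    exact Exec.skip _
  | cons a w ih =>
    have := ih.seq (Runs.push (L := L.set q (w ++ L.getD q [])) (r := q) (by simpa using hq) a)
    refine Runs.mono (b := (a :: w).length + 1) ?_ le_rfl
    simpa [hq, Prog.pushWord] using this

/-! ### Moving words between registers -/

/-- Empty register `r`, prepending `φ s` to register `q` for every symbol `s`. -/
def Prog.drain (r q : ℕ) (φ : Sym → Word) : Prog := Prog.forSym r fun s => Prog.pushWord q (φ s)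

theorem Runs.drain {L : List Word} {r q : ℕ} (hr : r < L.length) (hq : q < L.length) (hrq : r ≠ q)
    {φ : Sym → Word} {c : ℕ} (hφ : ∀ s, (φ s).length ≤ c) :
    Runs (Prog.drain r q φ) (initStore L)
      (initStore ((L.set r []).set q ((L.getD r []).foldl (fun g s => φ s ++ g) (L.getD q []))))
      ((c + 6) * (L.getD r []).length + 1) := by
  have := Runs.forSym (γ := Word) (r := r) (body := fun s => Prog.pushWord q (φ s))
    (step := fun g s => φ s ++ g) (fun w g => initStore ((L.set r w).set q g))
    (by intro w g; simp [initStore, List.getD, hr, hrq.symm])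
    (by
      intro s w g
      rw [update_initStore (by simpa using hr), List.set_comm _ _ hrq.symm, List.set_set])
    (fun _ _ => True) (c := c + 1)
    (by
      intro s w g _
      refine ⟨?_, trivial⟩
      have := Runs.pushWord (L := (L.set r w).set q g) (q := q) (by simpa using hq) (φ s)
      rw [List.set_set, List.getD_eq_getElem _ _ (by simpa using hq), List.getElem_set_self] at this
      exact this.mono (by have := hφ s; omega))
    (L.getD r []) (L.getD q []) trivial
  have h : (L.set r (L.getD r [])).set q (L.getD q []) = L := by
    rw [List.getD_eq_getElem _ _ hr, List.getD_eq_getElem _ _ hq, List.set_getElem_self,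
      List.set_getElem_self]
  rw [h] at this
  exact this

theorem foldl_cons_eq (w g : Word) :
    w.foldl (fun g s => [s] ++ g) g = w.reverse ++ g := by
  simp

/-- Reverse register `r` onto register `q`. -/
abbrev Prog.move (r q : ℕ) : Prog := Prog.drain r q fun s => [s]

theorem Runs.move {L : List Word} {r q : ℕ} (hr : r < L.length) (hq : q < L.length) (hrq : r ≠ q) :
    Runs (Prog.move r q) (initStore L)
      (initStore ((L.set r []).set q ((L.getD r []).reverse ++ L.getD q [])))
      (7 * (L.getD r []).length + 1) := by
  rw [← foldl_cons_eq]
  exact Runs.drain hr hq hrq (c := 1) (by simp)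

/-- Copy register `0` to the empty register `1`. -/
def Prog.dup : Prog :=
  Prog.seq (Prog.move 0 2) (Prog.forSym 2 fun s => Prog.seq (Prog.push 0 s) (Prog.push 1 s))

/-- Reading a stack destroys and reverses it. The word is parked in reverse in register 2, and the
pass back writes both copies in the right order. -/
theorem Runs.dup (x : Word) :
    Runs Prog.dup (initStore [x]) (initStore [x, x]) (14 * x.length + 2) := by
  have h₁ : Runs (Prog.move 0 2) (initStore [x]) (initStore [[], [], x.reverse])
      (7 * x.length + 1) := by
    have := Runs.move (L := [x, [], []]) (r := 0) (q := 2) (by simp) (by simp) (by simp)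
    rw [show initStore [x, [], []] = initStore [x] from
      (initStore_append_nil [x, []]).trans (initStore_append_nil [x])] at this
    simpa using this
  have h₂ := Runs.forSym (γ := Word) (r := 2)
    (body := fun s => Prog.seq (Prog.push 0 s) (Prog.push 1 s)) (step := fun g s => [s] ++ g)
    (fun w g => initStore [g, g, w]) (fun _ _ => rfl) (fun s w g => update_initStore (by simp) w)
    (fun _ _ => True) (c := 2)
    (fun s w g _ => ⟨(Runs.push (L := [g, g, w]) (r := 0) (by simp) s).seq
      (Runs.push (L := [s :: g, g, w]) (r := 1) (by simp) s), trivial⟩) x.reverse [] trivial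
  rw [foldl_cons_eq, List.reverse_reverse, List.append_nil,
    show initStore [x, x, []] = initStore [x, x] from initStore_append_nil [x, x]] at h₂
  refine (h₁.seq h₂).mono ?_
  rw [List.length_reverse]
  omega

/-! ### Pairs of words -/

/-- A self-delimiting encoding of pairs of words. -/
def pairWord (a b : Word) : Word := a.foldr (fun s g => Sym.one :: s :: g) (Sym.zero :: b)

theorem length_pairWord (a b : Word) : (pairWord a b).length = 2 * a.length + 1 + b.length := by
  induction a with
  | nil => simp [pairWord]; omega
  | cons s a ih =>
    simp only [pairWord, List.foldr_cons, List.length_cons] at ih ⊢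
    omega

/-- Combine register `1` and register `0` to a pair. -/
def Prog.mkPair : Prog :=
  Prog.seq (Prog.move 1 2) (Prog.seq (Prog.push 0 Sym.zero) (Prog.drain 2 0 fun s => [Sym.one, s]))

theorem Runs.mkPair (a b : Word) :
    Runs Prog.mkPair (initStore [b, a]) (initStore [pairWord a b]) (15 * a.length + 3) := by
  have h₁ : Runs (Prog.move 1 2) (initStore [b, a]) (initStore [b, [], a.reverse])
      (7 * a.length + 1) := by
    have := Runs.move (L := [b, a, []]) (r := 1) (q := 2) (by simp) (by simp) (by simp)
    rw [show initStore [b, a, []] = initStore [b, a] from initStore_append_nil [b, a]] at this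
    simpa using this
  have h₂ := Runs.push (L := [b, [], a.reverse]) (r := 0) (by simp) Sym.zero
  have h₃ := Runs.drain (L := [Sym.zero :: b, [], a.reverse]) (r := 2) (q := 0) (by simp) (by simp)
    (by simp) (φ := fun s => [Sym.one, s]) (c := 2) (by simp)
  have h₄ : initStore [pairWord a b, [], []] = initStore [pairWord a b] :=
    (initStore_append_nil [pairWord a b, []]).trans (initStore_append_nil [pairWord a b])
  rw [← h₄]
  have h := (h₁.seq (h₂.seq (h₃.mono (b := 8 * a.length + 1) (by simp)))).mono
    (b := 15 * a.length + 3) (by omega)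
  simpa [pairWord, Prog.mkPair] using h

/-- Split the pair in register `0`: the first component goes to register `1`, in reverse. -/
def Prog.unpair : Prog :=
  Prog.seq
    (Prog.loop 0 (fun o => decide (o = some Sym.one))
      (Prog.seq (Prog.pop 0)
        (Prog.seq (Prog.caseTop 0 fun o => o.elim Prog.skip fun s => Prog.push 1 s)
          (Prog.pop 0))))
    (Prog.pop 0)

/-- In a pair, each symbol of the first component is preceded by the marker `Sym.one` and `Sym.zero`
closes the component, so the top symbol alone decides whether the loop goes on. -/
theorem Runs.unpair (a b : Word) :
    Runs Prog.unpair (initStore [pairWord a b]) (initStore [b, a.reverse])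
      (7 * a.length + 2) := by
  rw [← initStore_append_nil]
  have key : ∀ a g : Word, Runs (Prog.loop 0 (fun o => decide (o = some Sym.one))
      (Prog.seq (Prog.pop 0)
        (Prog.seq (Prog.caseTop 0 fun o => o.elim Prog.skip fun s => Prog.push 1 s)
          (Prog.pop 0)))) (initStore [pairWord a b, g])
      (initStore [Sym.zero :: b, a.reverse ++ g]) (7 * a.length + 1) := by
    intro a
    induction a with
    | nil => exact fun g => ⟨1, by simp, Exec.loop_false (by simp [initStore, pairWord])⟩
    | cons s a ih =>
      intro g
      obtain ⟨t, ht, e⟩ := ih (s :: g)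
      have h₁ := Runs.pop (L := [pairWord (s :: a) b, g]) (r := 0) (by simp)
      have h₂ : Runs (Prog.caseTop 0 fun o => o.elim Prog.skip fun s => Prog.push 1 s)
          (initStore [s :: pairWord a b, g]) (initStore [s :: pairWord a b, s :: g]) (1 + 3) :=
        Runs.caseTop (Runs.push (L := [s :: pairWord a b, g]) (r := 1) (by simp) s)
      have h₃ := Runs.pop (L := [s :: pairWord a b, s :: g]) (r := 0) (by simp)
      obtain ⟨t', ht', e'⟩ := h₁.seq (h₂.seq h₃)
      refine ⟨t' + t + 1, by simp only [List.length_cons]; omega, ?_⟩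
      have := Exec.loop_true (r := 0) (test := fun o => decide (o = some Sym.one))
        (by simp [initStore, pairWord]) e' e
      simpa using this
  have h := (key a []).seq (Runs.pop (L := [Sym.zero :: b, a.reverse ++ []]) (r := 0) (by simp))
  simpa [Prog.unpair] using h

/-! ### Encoded types and functions computable in polynomial time -/

/-- A type whose elements are represented by words. -/
class Enc (α : Type) where
  enc : α → Word

open Enc

variable {α β γ : Type} [Enc α] [Enc β] [Enc γ]

/-- The length of the representation. -/
def esize (a : α) : ℕ := (enc a).length

/-- A numerical function that is bounded by a polynomial in the size of its argument. -/
def PolyBdd (φ : α → ℕ) : Prop := ∃ B : Polynomial ℕ, ∀ a, φ a ≤ B.eval (esize a)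

theorem PolyBdd.mono {φ ψ : α → ℕ} (h : PolyBdd φ) (hle : ∀ a, ψ a ≤ φ a) : PolyBdd ψ :=
  let ⟨B, hB⟩ := h
  ⟨B, fun a => (hle a).trans (hB a)⟩

theorem PolyBdd.const (c : ℕ) : PolyBdd fun _ : α => c := ⟨Polynomial.C c, by simp⟩

theorem PolyBdd.esize : PolyBdd fun a : α => esize a := ⟨Polynomial.X, by simp⟩

theorem PolyBdd.add {φ ψ : α → ℕ} (h : PolyBdd φ) (h' : PolyBdd ψ) :
    PolyBdd fun a => φ a + ψ a := by
  obtain ⟨B, hB⟩ := h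
  obtain ⟨C, hC⟩ := h'
  exact ⟨B + C, fun a => by rw [Polynomial.eval_add]; exact Nat.add_le_add (hB a) (hC a)⟩

theorem PolyBdd.mul {φ ψ : α → ℕ} (h : PolyBdd φ) (h' : PolyBdd ψ) :
    PolyBdd fun a => φ a * ψ a := by
  obtain ⟨B, hB⟩ := h
  obtain ⟨C, hC⟩ := h'
  exact ⟨B * C, fun a => by rw [Polynomial.eval_mul]; exact Nat.mul_le_mul (hB a) (hC a)⟩

theorem PolyBdd.eval {φ : α → ℕ} (h : PolyBdd φ) (T : Polynomial ℕ) :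
    PolyBdd fun a => T.eval (φ a) := by
  obtain ⟨B, hB⟩ := h
  exact ⟨T.comp B, fun a => by rw [Polynomial.eval_comp]; exact polynomial_eval_mono T (hB a)⟩

/-- `f` is computed in polynomial time by a program that uses register `0` for input and output and
leaves all other registers empty. -/
def PT (f : α → β) : Prop :=
  ∃ (p : Prog) (T : Polynomial ℕ), ∀ a,
    Runs p (initStore [enc a]) (initStore [enc (f a)]) (T.eval (esize a))

theorem PT.of_runs {f : α → β} {p : Prog} {φ : α → ℕ} (hφ : PolyBdd φ)
    (h : ∀ a, Runs p (initStore [enc a]) (initStore [enc (f a)]) (φ a)) : PT f :=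
  let ⟨B, hB⟩ := hφ
  ⟨p, B, fun a => (h a).mono (hB a)⟩

theorem PT.polyBdd {f : α → β} (h : PT f) : PolyBdd fun a => FairDensest.esize (f a) := by
  obtain ⟨p, T, h⟩ := h
  refine ⟨Polynomial.X + T, fun a => ?_⟩
  obtain ⟨t, ht, e⟩ := h a
  have := e.length_le 0
  simp only [initStore, List.getD_cons_zero] at this
  simp only [FairDensest.esize, Polynomial.eval_add, Polynomial.eval_X] at ht ⊢
  omega

theorem PT.id : PT (fun a : α => a) :=
  PT.of_runs (PolyBdd.const 1) fun _ => ⟨1, le_rfl, Exec.skip _⟩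

/-- Plain sequencing works because `PT` programs leave no garbage. The time of the second program is
polynomial because the output of the first has polynomial size. -/
theorem PT.comp {g : β → γ} {f : α → β} (hg : PT g) (hf : PT f) : PT fun a => g (f a) := by
  obtain ⟨p, T, hp⟩ := hf
  obtain ⟨q, U, hq⟩ := hg
  refine PT.of_runs (p := Prog.seq p q) ?_ fun a => (hp a).seq (hq (f a))
  exact (PolyBdd.esize.eval T).add ((PT.polyBdd ⟨p, T, hp⟩).eval U)

/-- Functions whose values have the same representations are equally hard to compute. -/
theorem PT.congr_enc {f : α → β} (hf : PT f) {α' β' : Type} [Enc α'] [Enc β'] {f' : α' → β'}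
    (i : α' → α) (hi : ∀ a, enc a = enc (i a)) (ho : ∀ a, enc (f' a) = enc (f (i a))) : PT f' := by
  obtain ⟨p, T, hp⟩ := hf
  refine ⟨p, T, fun a => ?_⟩
  rw [esize, hi, ho]
  exact hp (i a)

theorem PT.const (c : β) : PT fun _ : α => c := by
  refine PT.of_runs (p := Prog.seq (Prog.clear 0) (Prog.pushWord 0 (enc c)))
    (φ := fun a => (6 * esize a + 1) + ((enc c).length + 1)) ?_ fun a => ?_
  · exact (((PolyBdd.const 6).mul PolyBdd.esize).add (PolyBdd.const 1)).add (PolyBdd.const _)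
  · have := (Runs.clear_initStore (L := [enc a]) (r := 0) (by simp)).seq
      (Runs.pushWord (L := [[]]) (q := 0) (by simp) (enc c))
    simpa [esize] using this

instance : Enc Word := ⟨fun w => w⟩

instance : Enc Bool := ⟨fun b => [bit b]⟩

/-- Natural numbers are represented in unary. -/
instance : Enc ℕ := ⟨fun n => List.replicate n Sym.one⟩

instance : Enc (α × β) := ⟨fun x => pairWord (enc x.1) (enc x.2)⟩

@[simp] theorem enc_word (w : Word) : enc w = w := rfl

@[simp] theorem esize_word (w : Word) : esize w = w.length := rfl

@[simp] theorem esize_bool (b : Bool) : esize b = 1 := rfl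

@[simp] theorem esize_nat (n : ℕ) : esize n = n := by simp [esize, enc]

@[simp] theorem esize_prod (x : α × β) : esize x = 2 * esize x.1 + 1 + esize x.2 :=
  length_pairWord _ _

theorem PT.pair {f : α → β} {g : α → γ} (hf : PT f) (hg : PT g) : PT fun a => (f a, g a) := by
  have hB := hf.polyBdd
  obtain ⟨p, T, hp⟩ := hf
  obtain ⟨q, U, hq⟩ := hg
  refine PT.of_runs (p := Prog.seq Prog.dup (Prog.seq (q.callAt 0 2)
    (Prog.seq (p.callAt 1 2) Prog.mkPair)))
    (φ := fun a => (14 * esize a + 2) + (U.eval (esize a) + (T.eval (esize a) +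
      (15 * esize (f a) + 3)))) ?_ fun a => ?_
  · exact (((PolyBdd.const _).mul PolyBdd.esize).add (PolyBdd.const _)).add
      ((PolyBdd.esize.eval U).add ((PolyBdd.esize.eval T).add
        (((PolyBdd.const _).mul hB).add (PolyBdd.const _))))
  · exact (Runs.dup _).seq ((Runs.callAt (L := [enc a, enc a]) rfl (by simp) (hq a)).seq
      ((Runs.callAt (L := [enc (g a), enc a]) (r := 1) rfl (by simp) (hp a)).seq
        (Runs.mkPair (enc (f a)) (enc (g a)))))

theorem PT.snd : PT (Prod.snd : α × β → β) := by
  refine PT.of_runs (p := Prog.seq Prog.unpair (Prog.clear 1))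
    (φ := fun x => (7 * esize x + 2) + (6 * esize x + 1)) ?_ fun x => ?_
  · exact (((PolyBdd.const _).mul PolyBdd.esize).add (PolyBdd.const _)).add
      (((PolyBdd.const _).mul PolyBdd.esize).add (PolyBdd.const _))
  · have := (Runs.unpair (enc x.1) (enc x.2)).seq
      (Runs.clear_initStore (L := [enc x.2, (enc x.1).reverse]) (r := 1) (by simp))
    rw [show initStore ([enc x.2, (enc x.1).reverse].set 1 []) = initStore [enc x.2] from
      initStore_append_nil [enc x.2]] at this
    refine this.mono ?_
    simp only [esize_prod, List.getD_cons_succ, List.getD_cons_zero, List.length_reverse]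
    unfold esize
    omega

theorem PT.fst : PT (Prod.fst : α × β → α) := by
  refine PT.of_runs (p := Prog.seq Prog.unpair (Prog.seq (Prog.clear 0) (Prog.move 1 0)))
    (φ := fun x => (7 * esize x + 2) + ((6 * esize x + 1) + (7 * esize x + 1))) ?_ fun x => ?_
  · exact (((PolyBdd.const _).mul PolyBdd.esize).add (PolyBdd.const _)).add
      ((((PolyBdd.const _).mul PolyBdd.esize).add (PolyBdd.const _)).add
        (((PolyBdd.const _).mul PolyBdd.esize).add (PolyBdd.const _)))
  · have h₁ := Runs.clear_initStore (L := [enc x.2, (enc x.1).reverse]) (r := 0) (by simp)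
    have h₂ := Runs.move (L := [[], (enc x.1).reverse]) (r := 1) (q := 0) (by simp) (by simp)
      (by simp)
    have h₃ := (Runs.unpair (enc x.1) (enc x.2)).seq (h₁.seq h₂)
    rw [show initStore (([[], (enc x.1).reverse].set 1 []).set 0
      (([[], (enc x.1).reverse].getD 1 []).reverse ++ [[], (enc x.1).reverse].getD 0 [])) =
        initStore [enc x.1] by
          rw [← initStore_append_nil [enc x.1]]
          simp] at h₃
    refine h₃.mono ?_
    simp only [esize_prod, List.getD_cons_succ, List.getD_cons_zero, List.length_reverse]
    unfold esize
    omega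

theorem PT.ite {c : α → Bool} {f g : α → β} (hc : PT c) (hf : PT f) (hg : PT g) :
    PT fun a => if c a = true then f a else g a := by
  obtain ⟨p, T, hp⟩ := hf
  obtain ⟨q, U, hq⟩ := hg
  obtain ⟨r, V, hr⟩ := hc
  refine PT.of_runs (p := Prog.seq Prog.dup (Prog.seq (r.callAt 1 2)
    (Prog.caseTop 1 fun o => Prog.seq (Prog.pop 1) (if o = some Sym.one then p else q))))
    (φ := fun a => (14 * esize a + 2) + (V.eval (esize a) +
      (1 + (T.eval (esize a) + U.eval (esize a)) + 3))) ?_ fun a => ?_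
  · exact (((PolyBdd.const _).mul PolyBdd.esize).add (PolyBdd.const _)).add
      ((PolyBdd.esize.eval V).add (((PolyBdd.const _).add
        ((PolyBdd.esize.eval T).add (PolyBdd.esize.eval U))).add (PolyBdd.const _)))
  · refine (Runs.dup _).seq ((Runs.callAt (L := [enc a, enc a]) (r := 1) rfl (by simp) (hr a)).seq
      (Runs.caseTop (Runs.seq (Runs.pop (L := [enc a, enc (c a)]) (r := 1) (by simp)) ?_)))
    rw [show initStore ([enc a, enc (c a)].set 1 ([enc a, enc (c a)].getD 1 []).tail) =
      initStore [enc a] from initStore_append_nil [enc a]]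
    change Runs (if some (bit (c a)) = some Sym.one then p else q) _ _ _
    cases c a with
    | true =>
      simp only [bit, if_true]
      exact (hp a).mono (by omega)
    | false =>
      simp only [bit]
      exact (hq a).mono (by omega)

/-- Recursion along a word, as long as the states are of polynomial size. -/
theorem PT.foldl {w : α → Word} {init : α → β} {step : Sym → β → β} (hw : PT w) (hi : PT init)
    (hs : ∀ s, PT (step s)) {φ : α → ℕ} (hφ : PolyBdd φ)
    (hb : ∀ a v, v <+: w a → esize (v.foldl (fun b s => step s b) (init a)) ≤ φ a) :
    PT fun a => (w a).foldl (fun b s => step s b) (init a) := by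
  choose q U hq using hs
  have hwB := hw.polyBdd
  obtain ⟨p, T, hp⟩ := hw.pair hi
  refine PT.of_runs (p := Prog.seq p (Prog.seq Prog.unpair (Prog.seq (Prog.move 1 2)
    (Prog.forSym 2 fun s => (q s).callAt 0 3))))
    (φ := fun a => T.eval (esize a) + ((7 * esize (w a) + 2) + ((7 * esize (w a) + 1) +
      ((((U Sym.zero).eval (φ a) + (U Sym.one).eval (φ a) + (U Sym.sep).eval (φ a)) + 5) *
        esize (w a) + 1)))) ?_ fun a => ?_
  · have h7 := (PolyBdd.const 7).mul hwB
    exact (PolyBdd.esize.eval T).add ((h7.add (PolyBdd.const _)).add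
      ((h7.add (PolyBdd.const _)).add (((((hφ.eval _).add (hφ.eval _)).add (hφ.eval _)).add
        (PolyBdd.const _)).mul hwB |>.add (PolyBdd.const _))))
  · refine (hp a).seq ((Runs.unpair (w a) (enc (init a))).seq (Runs.seq
      (τ := initStore [enc (init a), [], w a]) ?_ ?_))
    · have := Runs.move (L := [enc (init a), (w a).reverse, []]) (r := 1) (q := 2) (by simp)
        (by simp) (by simp)
      rw [show initStore [enc (init a), (w a).reverse, []] =
        initStore [enc (init a), (w a).reverse] from initStore_append_nil [_, _]] at this
      simpa using this
    · have := Runs.forSym (γ := β) (r := 2) (body := fun s => (q s).callAt 0 3)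
        (step := fun b s => step s b) (fun v b => initStore [enc b, [], v]) (fun _ _ => rfl)
        (fun s v b => update_initStore (by simp) v)
        -- The current state is the fold over the prefix already read, which is what `hb` bounds; so
        -- every round runs on a state of polynomial size.
        (fun v b => ∃ u, u ++ v = w a ∧ b = u.foldl (fun b s => step s b) (init a))
        (c := (U Sym.zero).eval (φ a) + (U Sym.one).eval (φ a) + (U Sym.sep).eval (φ a))
        (by
          rintro s v b ⟨u, hu, rfl⟩
          refine ⟨?_, u ++ [s], by simpa using hu, by simp⟩
          have h₁ := Runs.callAt (r := 0) (m := 3)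
            (L := [enc (u.foldl (fun b s => step s b) (init a)), [], v]) rfl (by omega) (hq s _)
          refine h₁.mono ?_
          have h₂ := polynomial_eval_mono (U s) (hb a u ⟨s :: v, hu⟩)
          refine h₂.trans ?_
          cases s <;> omega)
        (w a) (init a) ⟨[], rfl, rfl⟩
      rw [show initStore [enc ((w a).foldl (fun b s => step s b) (init a)), [], []] =
        initStore [enc ((w a).foldl (fun b s => step s b) (init a))] from
          (initStore_append_nil [_, []]).trans (initStore_append_nil [_])] at this
      exact this

/-- A unary number is a word of ones, so iteration is a fold over it that ignores the symbols. -/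
theorem PT.iterate {n : α → ℕ} {init : α → β} {step : β → β} (hn : PT n) (hi : PT init)
    (hs : PT step) {φ : α → ℕ} (hφ : PolyBdd φ)
    (hb : ∀ a, ∀ i ≤ n a, esize (step^[i] (init a)) ≤ φ a) :
    PT fun a => step^[n a] (init a) := by
  have hw : PT fun a => List.replicate (n a) Sym.one :=
    hn.congr_enc (fun a => a) (fun _ => rfl) fun _ => rfl
  have := PT.foldl (step := fun _ => step) hw hi (fun _ => hs) hφ (by
    intro a v hv
    rw [List.foldl_const]
    exact hb a _ (by simpa using hv.length_le))
  simpa [List.foldl_const] using this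

/-! ### Relation to the one- and two-argument versions of polynomial time -/

/-- Run `p` and empty all registers but the first one. -/
theorem Exec.clean {p : Prog} {L : List Word} {τ : Store} {t B m : ℕ} (e : Exec p (initStore L) τ t)
    (hL : L.length ≤ m + 1) (hB : ∀ r, 0 < r → (L.getD r []).length ≤ B) :
    Runs (Prog.seq p (Prog.clearUpTo (p.width + m))) (initStore L) (initStore [τ 0])
      (t + ((6 * (B + t) + 1) * (p.width + m) + 1)) := by
  refine Runs.seq ⟨t, le_rfl, e⟩ ?_
  have := Runs.clearUpTo (p.width + m) τ (B + t) (by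
    intro r hr
    have h₁ := e.length_le r
    have h₂ := hB r hr
    simp only [initStore] at h₁
    omega)
  refine (?_ : _ = initStore [τ 0]) ▸ this
  funext r
  rcases Nat.eq_zero_or_pos r with rfl | hr
  · simp [initStore]
  · obtain ⟨r, rfl⟩ := Nat.exists_eq_succ_of_ne_zero hr.ne'
    by_cases h : r + 1 ≤ p.width + m
    · simp [initStore, h]
    · have h₁ : L.length ≤ r + 1 := by omega
      simp [initStore, h, e.eq_of_width_le (r + 1) (by omega), List.getD, h₁]

/-- A program for `PolyTime` may leave data in other registers. These are finitely many and no
longer than the running time, so wiping them costs polynomial time. -/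
theorem PolyTime.pT {f : Word → Word} (h : PolyTime f) : PT f := by
  obtain ⟨p, T, h⟩ := h
  refine PT.of_runs (p := Prog.seq p (Prog.clearUpTo (p.width + 0)))
    (φ := fun x => T.eval (esize x) + ((6 * (0 + T.eval (esize x)) + 1) * (p.width + 0) + 1))
    ?_ fun x => ?_
  · have := PolyBdd.esize (α := Word) |>.eval T
    exact this.add ((((PolyBdd.const _).mul ((PolyBdd.const _).add this)).add
      (PolyBdd.const _)).mul (PolyBdd.const _) |>.add (PolyBdd.const _))
  · obtain ⟨τ, t, e, h0, ht⟩ := h x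
    have := e.clean (m := 0) (B := 0) (by simp) (by
      intro r hr
      obtain ⟨r, rfl⟩ := Nat.exists_eq_succ_of_ne_zero hr.ne'
      simp)
    rw [h0] at this
    refine this.mono ?_
    have ht : t ≤ T.eval (esize x) := ht
    gcongr

theorem PT.polyTime {f : Word → Word} (h : PT f) : PolyTime f := by
  obtain ⟨p, T, h⟩ := h
  refine ⟨p, T, fun x => ?_⟩
  obtain ⟨t, ht, e⟩ := h x
  exact ⟨_, t, e, rfl, ht⟩

theorem PolyTime₂.pT {f : Word → Word → Word} (h : PolyTime₂ f) :
    PT fun x : Word × Word => f x.1 x.2 := by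
  obtain ⟨p, T, h⟩ := h
  -- After `unpair`, register 0 holds the second word and register 1 the reverse of the first. The
  -- three moves through register 2 reorder them as the inputs that `p` expects.
  refine PT.of_runs (p := Prog.seq Prog.unpair (Prog.seq (Prog.move 0 2) (Prog.seq (Prog.move 1 0)
    (Prog.seq (Prog.move 2 1) (Prog.seq p (Prog.clearUpTo (p.width + 1)))))))
    (φ := fun x => (7 * esize x + 2) + ((7 * esize x + 1) + ((7 * esize x + 1) +
      ((7 * esize x + 1) + (T.eval (esize x) +
        ((6 * (esize x + T.eval (esize x)) + 1) * (p.width + 1) + 1)))))) ?_ ?_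
  · have hT := PolyBdd.esize (α := Word × Word) |>.eval T
    have h7 := (PolyBdd.const 7).mul (PolyBdd.esize (α := Word × Word))
    exact (h7.add (PolyBdd.const _)).add ((h7.add (PolyBdd.const _)).add
      ((h7.add (PolyBdd.const _)).add ((h7.add (PolyBdd.const _)).add (hT.add
      ((((PolyBdd.const _).mul (PolyBdd.esize.add hT)).add
      (PolyBdd.const _)).mul (PolyBdd.const _) |>.add (PolyBdd.const _))))))
  · rintro ⟨x, y⟩
    obtain ⟨τ, t, e, h0, ht⟩ := h x y
    have hx : esize (x, y) = 2 * x.length + 1 + y.length := esize_prod _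
    have h₁ := Runs.unpair x y
    have h₂ := Runs.move (L := [y, x.reverse, []]) (r := 0) (q := 2) (by simp) (by simp) (by simp)
    rw [show initStore [y, x.reverse, []] = initStore [y, x.reverse] from
      initStore_append_nil [_, _]] at h₂
    have h₃ := Runs.move (L := [[], x.reverse, y.reverse ++ []]) (r := 1) (q := 0) (by simp)
      (by simp) (by simp)
    have h₄ := Runs.move (L := [x.reverse.reverse ++ [], [], y.reverse ++ []]) (r := 2) (q := 1)
      (by simp) (by simp) (by simp)
    rw [show initStore (([x.reverse.reverse ++ [], [], y.reverse ++ []].set 2 []).set 1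
      (([x.reverse.reverse ++ [], [], y.reverse ++ []].getD 2 []).reverse ++
        [x.reverse.reverse ++ [], [], y.reverse ++ []].getD 1 [])) = initStore [x, y] by
          rw [← initStore_append_nil [x, y]]
          simp] at h₄
    have h₅ := e.clean (m := 1) (B := y.length) (by simp) (by
      intro r hr
      match r, hr with
      | 1, _ => simp
      | r + 2, _ => simp)
    rw [h0] at h₅
    have ht : t ≤ T.eval (esize (x, y)) :=
      ht.trans (polynomial_eval_mono T (by rw [hx]; omega))
    have hy : y.length ≤ esize (x, y) := by rw [hx]; omega
    refine ((h₁.mono ?_).seq ((h₂.mono ?_).seq ((h₃.mono ?_).seq ((h₄.mono ?_).seq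
      (h₅.mono ?_)))))
    · rw [hx]; omega
    · rw [hx]; simp
    · rw [hx]; simp; omega
    · rw [hx]; simp
    · gcongr

theorem PT.polyTime₂ {f : Word → Word → Word} (h : PT fun x : Word × Word => f x.1 x.2) :
    PolyTime₂ f := by
  -- `mkPair` takes its first component from register 1, so the pair arrives as `(y, x)`; hence the
  -- swap.
  obtain ⟨p, T, h⟩ := h.comp (PT.snd.pair (PT.fst (α := Word) (β := Word)))
  refine ⟨Prog.seq Prog.mkPair p,
    (15 * Polynomial.X + 3) + T.comp (2 * Polynomial.X + 1), fun x y => ?_⟩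
  obtain ⟨t, ht, e⟩ := (Runs.mkPair y x).seq (h (y, x))
  refine ⟨_, t, e, rfl, ht.trans ?_⟩
  simp only [Polynomial.eval_add, Polynomial.eval_mul, Polynomial.eval_comp, Polynomial.eval_X,
    Polynomial.eval_ofNat, Polynomial.eval_one]
  refine Nat.add_le_add (by omega) (polynomial_eval_mono T ?_)
  rw [esize_prod, esize_word, esize_word]
  change 2 * y.length + 1 + x.length ≤ _
  omega

/-! ### Words and truth values -/

theorem PT.cons (s : Sym) : PT fun w : Word => s :: w :=
  PT.of_runs (PolyBdd.const 1) fun w => Runs.push (L := [w]) (r := 0) (by simp) s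

theorem PT.tail : PT fun w : Word => w.tail :=
  PT.of_runs (PolyBdd.const 1) fun w => Runs.pop (L := [w]) (r := 0) (by simp)

/-- Functions of the first symbol. -/
theorem PT.head (F : Option Sym → β) : PT fun w : Word => F w.head? := by
  refine PT.of_runs
    (p := Prog.caseTop 0 fun o => Prog.seq (Prog.clear 0) (Prog.pushWord 0 (enc (F o))))
    (φ := fun w => ((6 * esize w + 1) + (esize (F none) + esize (F (some Sym.zero)) +
      esize (F (some Sym.one)) + esize (F (some Sym.sep)) + 1)) + 3) ?_ fun w => ?_
  · exact ((((PolyBdd.const _).mul PolyBdd.esize).add (PolyBdd.const _)).add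
      (PolyBdd.const _)).add (PolyBdd.const _)
  · refine Runs.caseTop ((Runs.clear_initStore (L := [w]) (r := 0) (by simp)).seq ?_)
    have := Runs.pushWord (L := [[]]) (q := 0) (by simp) (enc (F w.head?))
    rw [List.getD_cons_zero, List.append_nil] at this
    refine this.mono ?_
    unfold esize
    match w.head? with
    | none => omega
    | some Sym.zero => omega
    | some Sym.one => omega
    | some Sym.sep => omega

/-- Functions of a truth value. -/
theorem PT.bool (F : Bool → β) {f : α → Bool} (hf : PT f) : PT fun a => F (f a) := by
  have := hf.ite (PT.const (F true)) (PT.const (F false))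
  refine this.congr_enc (fun a => a) (fun _ => rfl) fun a => ?_
  cases f a <;> rfl

theorem PT.bool₂ (F : Bool → Bool → β) {f g : α → Bool} (hf : PT f) (hg : PT g) :
    PT fun a => F (f a) (g a) := by
  have := hf.ite (hg.bool (F true)) (hg.bool (F false))
  refine this.congr_enc (fun a => a) (fun _ => rfl) fun a => ?_
  cases f a <;> rfl

theorem PT.bool₃ (F : Bool → Bool → Bool → β) {f g h : α → Bool} (hf : PT f) (hg : PT g)
    (hh : PT h) : PT fun a => F (f a) (g a) (h a) := by
  have := hf.ite (hg.bool₂ (F true) hh) (hg.bool₂ (F false) hh)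
  refine this.congr_enc (fun a => a) (fun _ => rfl) fun a => ?_
  cases f a <;> rfl

theorem PT.reverse : PT fun w : Word => w.reverse := by
  have := PT.foldl (w := fun w : Word => w) (init := fun _ => ([] : Word))
    (step := fun s b => s :: b) PT.id (PT.const _) (fun s => PT.cons s) PolyBdd.esize (by
      intro w v hv
      simpa using hv.length_le)
  simpa using this

theorem PT.append : PT fun x : Word × Word => x.1 ++ x.2 := by
  have := PT.foldl (w := fun x : Word × Word => x.1.reverse) (init := fun x => x.2)
    (step := fun s b => s :: b) (PT.reverse.comp PT.fst) PT.snd (fun s => PT.cons s)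
    (φ := fun x => esize x) PolyBdd.esize (by
      intro x v hv
      have h := hv.length_le
      rw [List.length_reverse] at h
      have h' : v.foldl (fun b s => s :: b) x.2 = v.reverse ++ x.2 := foldl_cons_eq v x.2
      rw [esize_prod, esize_word, esize_word, esize_word, h', List.length_append,
        List.length_reverse]
      omega)
  simpa using this

/-- Prepend the symbol `bit b`. -/
theorem PT.consBit {f : α → Bool} {g : α → Word} (hf : PT f) (hg : PT g) :
    PT fun a => bit (f a) :: g a := by
  have := hf.ite ((PT.cons Sym.one).comp hg) ((PT.cons Sym.zero).comp hg)
  refine this.congr_enc (fun a => a) (fun _ => rfl) fun a => ?_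
  cases f a <;> rfl

/-! ### Unary arithmetic -/

theorem PT.succ : PT fun n : ℕ => n + 1 :=
  (PT.cons Sym.one).congr_enc (fun n : ℕ => (enc n : Word)) (fun _ => rfl) fun _ => rfl

theorem PT.pred : PT fun n : ℕ => n.pred :=
  PT.tail.congr_enc (fun n : ℕ => (enc n : Word)) (fun _ => rfl) fun n => by
    cases n <;> simp [enc, List.replicate_succ]

theorem PT.isPos : PT fun n : ℕ => decide (0 < n) :=
  (PT.head fun o => o.isSome).congr_enc (fun n : ℕ => (enc n : Word)) (fun _ => rfl) fun n => by
    cases n <;> simp [enc, List.replicate_succ]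

theorem PT.natAdd : PT fun x : ℕ × ℕ => x.1 + x.2 :=
  PT.append.congr_enc (fun x : ℕ × ℕ => ((enc x.1 : Word), (enc x.2 : Word))) (fun _ => rfl)
    fun x => by simp [enc, List.replicate_append_replicate]

theorem PolyBdd.of_pT {n : α → ℕ} (h : PT n) : PolyBdd n :=
  h.polyBdd.mono fun a => by simp

theorem PT.natMul : PT fun x : ℕ × ℕ => x.1 * x.2 := by
  have key : ∀ (m i : ℕ), (fun y : ℕ × ℕ => (y.1, y.1 + y.2))^[i] (m, 0) = (m, m * i) := by
    intro m i
    induction i with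
    | zero => simp
    | succ i ih => rw [Function.iterate_succ_apply', ih, Nat.mul_succ, Nat.add_comm]
  have h₁ := PolyBdd.of_pT (PT.fst (α := ℕ) (β := ℕ))
  have h₂ := PolyBdd.of_pT (PT.snd (α := ℕ) (β := ℕ))
  have := PT.iterate (n := fun x : ℕ × ℕ => x.2) (init := fun x => (x.1, 0))
    (step := fun y : ℕ × ℕ => (y.1, y.1 + y.2)) PT.snd (PT.fst.pair (PT.const 0))
    (PT.fst.pair PT.natAdd) (φ := fun x => 2 * x.1 + 1 + x.1 * x.2)
    ((((PolyBdd.const _).mul h₁).add (PolyBdd.const _)).add (h₁.mul h₂)) (by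
      intro x i hi
      rw [key]
      simp only [esize_prod, esize_nat]
      gcongr)
  have := PT.snd.comp this
  simpa only [key] using this

theorem PT.natSub : PT fun x : ℕ × ℕ => x.1 - x.2 := by
  have := PT.iterate (n := fun x : ℕ × ℕ => x.2) (init := fun x => x.1)
    (step := Nat.pred) PT.snd PT.fst PT.pred (PolyBdd.of_pT (PT.fst (α := ℕ) (β := ℕ))) (by
      intro x i hi
      rw [Nat.pred_iterate, esize_nat]
      exact Nat.sub_le _ _)
  simpa only [Nat.pred_iterate] using this

theorem PT.natLt {f g : α → ℕ} (hf : PT f) (hg : PT g) : PT fun a => decide (f a < g a) := by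
  have := PT.isPos.comp (PT.natSub.comp (hg.pair hf))
  simpa using this

theorem PT.natEq {f g : α → ℕ} (hf : PT f) (hg : PT g) : PT fun a => decide (f a = g a) := by
  have := PT.bool₂ (fun x y => !x && !y) (hf.natLt hg) (hg.natLt hf)
  refine this.congr_enc (fun a => a) (fun _ => rfl) fun a => ?_
  congr 1
  rcases lt_trichotomy (f a) (g a) with h | h | h
  · simp [h, h.ne]
  · simp [h]
  · have hne : f a ≠ g a := h.ne'
    simp [h, hne]

/-! ### Recursion over a range -/

/-- Indices are unary and at most `n a`, so one polynomial bound in `a` serves all of them. -/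
theorem PolyBdd.range {n : α → ℕ} (hn : PT n) {f : α × ℕ → β} (hf : PT f) :
    ∃ ψ : α → ℕ, PolyBdd ψ ∧ ∀ a i, i ≤ n a → FairDensest.esize (f (a, i)) ≤ ψ a := by
  obtain ⟨B, hB⟩ := hf.polyBdd
  refine ⟨fun a => B.eval (2 * FairDensest.esize a + 1 + n a), ?_, fun a i hi => ?_⟩
  · exact ((((PolyBdd.const _).mul PolyBdd.esize).add (PolyBdd.const _)).add
      (PolyBdd.of_pT hn)).eval B
  · refine (hB (a, i)).trans (polynomial_eval_mono B ?_)
    rw [esize_prod, esize_nat]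
    gcongr

/-- The iterated state consists of the parameter `a`, which `f` needs in each round, the counter and
the accumulator. -/
theorem PT.rangeFold {n : α → ℕ} {f : α × ℕ → γ} {op : β × γ → β} (b₀ : β) (hn : PT n)
    (hf : PT f) (hop : PT op) {φ : α → ℕ} (hφ : PolyBdd φ)
    (hb : ∀ a, ∀ i ≤ n a,
      esize ((List.range i).foldl (fun b j => op (b, f (a, j))) b₀) ≤ φ a) :
    PT fun a => (List.range (n a)).foldl (fun b j => op (b, f (a, j))) b₀ := by
  have key : ∀ (a : α) (i : ℕ),
      (fun x : α × (ℕ × β) => (x.1, (x.2.1 + 1, op (x.2.2, f (x.1, x.2.1)))))^[i] (a, (0, b₀)) =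
        (a, (i, (List.range i).foldl (fun b j => op (b, f (a, j))) b₀)) := by
    intro a i
    induction i with
    | zero => simp
    | succ i ih => rw [Function.iterate_succ_apply', ih, List.range_succ, List.foldl_append]; simp
  have h₁ : PT fun x : α × (ℕ × β) => x.2.1 := PT.fst.comp PT.snd
  have h₂ : PT fun x : α × (ℕ × β) => x.2.2 := PT.snd.comp PT.snd
  have := PT.iterate (n := n) (init := fun a => (a, (0, b₀)))
    (step := fun x : α × (ℕ × β) => (x.1, (x.2.1 + 1, op (x.2.2, f (x.1, x.2.1)))))
    hn (PT.id.pair (PT.const _))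
    (PT.fst.pair ((PT.succ.comp h₁).pair (hop.comp (h₂.pair (hf.comp (PT.fst.pair h₁))))))
    (φ := fun a => 2 * esize a + 1 + (2 * n a + 1 + φ a))
    ((((PolyBdd.const _).mul PolyBdd.esize).add (PolyBdd.const _)).add
      ((((PolyBdd.const _).mul (PolyBdd.of_pT hn)).add (PolyBdd.const _)).add hφ)) (by
      intro a i hi
      rw [key]
      simp only [esize_prod, esize_nat]
      have := hb a i hi
      gcongr)
  have := PT.snd.comp (PT.snd.comp this)
  simpa only [key] using this

theorem PT.flatMap {n : α → ℕ} {f : α × ℕ → Word} (hn : PT n) (hf : PT f) :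
    PT fun a => (List.range (n a)).flatMap fun i => f (a, i) := by
  obtain ⟨ψ, hψ, hle⟩ := PolyBdd.range hn hf
  have key : ∀ (a : α) (i : ℕ), (List.range i).foldl (fun b j => b ++ f (a, j)) [] =
      (List.range i).flatMap fun i => f (a, i) := by
    intro a i
    induction i with
    | zero => simp
    | succ i ih => simp [List.range_succ, ih]
  have := PT.rangeFold (op := fun x : Word × Word => x.1 ++ x.2) [] hn hf PT.append
    (φ := fun a => n a * ψ a) ((PolyBdd.of_pT hn).mul hψ) (by
      intro a i hi
      rw [key]
      have : ∀ j ≤ i, esize ((List.range j).flatMap fun i => f (a, i)) ≤ j * ψ a := by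
        intro j
        induction j with
        | zero => simp
        | succ j ih =>
          intro hj
          have h₁ := ih (by omega)
          have h₂ := hle a j (by omega)
          rw [esize_word] at h₁ h₂ ⊢
          rw [List.range_succ, List.flatMap_append, List.length_append, Nat.succ_mul]
          simpa using Nat.add_le_add h₁ h₂
      exact (this i le_rfl).trans (Nat.mul_le_mul_right _ hi))
  simpa only [key] using this

/-- The number of indices below a bound that satisfy a test. -/
theorem PT.count {n : α → ℕ} {c : α × ℕ → Bool} (hn : PT n) (hc : PT c) :
    PT fun a => ((Finset.range (n a)).filter fun i => c (a, i) = true).card := by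
  have := PT.flatMap hn (hc.ite (PT.const [Sym.one]) (PT.const ([] : Word)))
  refine this.congr_enc (fun a => a) (fun _ => rfl) fun a => ?_
  induction n a with
  | zero => simp [enc]
  | succ i ih =>
    rw [List.range_succ, List.flatMap_append, enc_word] at *
    rw [← ih, Finset.range_add_one, Finset.filter_insert]
    by_cases h : c (a, i) = true
    · simp [h, enc, List.replicate_succ']
    · simp [h, enc]

/-! ### Binary arithmetic -/

/-- Natural numbers, represented in binary. -/
structure Bin where
  val : ℕ

/-- The binary digits, least significant first. -/
def bitsWord (n : ℕ) : Word := (Nat.bits n).map bit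

instance : Enc Bin := ⟨fun n => bitsWord n.val⟩

theorem length_bitsWord (n : ℕ) : (bitsWord n).length = n.size := by
  rw [bitsWord, List.length_map, Nat.size_eq_bits_len]

@[simp] theorem esize_bin (n : Bin) : esize n = n.val.size := length_bitsWord _

@[simp] theorem bitsWord_zero : bitsWord 0 = [] := by simp [bitsWord]

theorem bitsWord_of_ne_zero {n : ℕ} (h : n ≠ 0) :
    bitsWord n = bit (decide (n % 2 = 1)) :: bitsWord (n / 2) := by
  have h2 := Nat.div_add_mod n 2
  rcases Nat.mod_two_eq_zero_or_one n with h0 | h1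
  · have : n / 2 ≠ 0 := by omega
    conv_lhs => rw [← h2, h0, Nat.add_zero]
    rw [bitsWord, Nat.bit0_bits _ this]
    simp [bitsWord, h0]
  · conv_lhs => rw [← h2, h1]
    rw [bitsWord, Nat.bit1_bits]
    simp [bitsWord, h1]

/-- Whether a digit is `1`; missing digits are `0`. -/
def isOne (o : Option Sym) : Bool := decide (o = some Sym.one)

@[simp] theorem isOne_bit (b : Bool) : isOne (some (bit b)) = b := by cases b <;> rfl

theorem isOne_head_bitsWord (n : ℕ) : isOne (bitsWord n).head? = decide (n % 2 = 1) := by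
  by_cases h : n = 0
  · subst h; simp [isOne]
  · rw [bitsWord_of_ne_zero h]; simp

theorem tail_bitsWord (n : ℕ) : (bitsWord n).tail = bitsWord (n / 2) := by
  by_cases h : n = 0
  · subst h; simp
  · rw [bitsWord_of_ne_zero h]; simp

/-- The state is the carry and the digits written so far, the latest on top. -/
def carryStep (s : Sym) (x : Bool × Word) : Bool × Word :=
  (isOne (some s) && x.1, bit (xor (isOne (some s)) x.1) :: x.2)

/-- The state is the unread rest of the second summand, the carry and the digits written so far.
Once the second summand is exhausted, its digits count as zero. -/
def addStep (s : Sym) (x : Word × (Bool × Word)) : Word × (Bool × Word) :=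
  (x.1.tail, (Bool.atLeastTwo (isOne (some s)) (isOne x.1.head?) x.2.1,
    bit (xor (isOne (some s)) (xor (isOne x.1.head?) x.2.1)) :: x.2.2))

def addFinish (x : Bool × Word) : Word := (if x.1 = true then Sym.one :: x.2 else x.2).reverse

/-- Ripple-carry addition of a carry. -/
def incWord (b : Word) (x : Bool × Word) : Bool × Word := b.foldl (fun x s => carryStep s x) x

/-- Ripple-carry addition. -/
def addWord (a : Word) (x : Word × (Bool × Word)) : Word :=
  let y := a.foldl (fun x s => addStep s x) x
  addFinish (incWord y.1 y.2)

theorem incWord_cons (b c : Bool) (w acc : Word) :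
    incWord (bit b :: w) (c, acc) = incWord w (b && c, bit (xor b c) :: acc) := by
  simp [incWord, carryStep]

theorem addWord_cons (b c : Bool) (w v acc : Word) :
    addWord (bit b :: w) (v, (c, acc)) = addWord w (v.tail,
      (Bool.atLeastTwo b (isOne v.head?) c, bit (xor b (xor (isOne v.head?) c)) :: acc)) := by
  simp [addWord, addStep]

/-- The result must be the canonical word, without leading zeros. This holds because the only digit
added at the top is a carry equal to 1. The induction follows n ↦ n/2, generalised over carry and
accumulator. -/
theorem addFinish_incWord (n : ℕ) : ∀ (c : Bool) (acc : Word),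
    addFinish (incWord (bitsWord n) (c, acc)) = acc.reverse ++ bitsWord (n + c.toNat) := by
  induction n using Nat.strong_induction_on with
  | _ n ih =>
    intro c acc
    by_cases h : n = 0
    · subst h
      cases c
      · simp [incWord, addFinish]
      · simp [incWord, addFinish, bitsWord, bit]
    · rw [bitsWord_of_ne_zero h, incWord_cons, ih (n / 2) (by omega),
        bitsWord_of_ne_zero (n := n + c.toNat) (by omega), List.reverse_cons,
        List.append_assoc, List.singleton_append]
      rcases Nat.mod_two_eq_zero_or_one n with h0 | h1
      · cases c
        · simp [h0]
        · have h₁ : (n + 1) % 2 = 1 := by omega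
          have h₂ : (n + 1) / 2 = n / 2 := by omega
          simp [h0, h₁, h₂]
      · cases c
        · simp [h1]
        · have h₁ : (n + 1) % 2 = 0 := by omega
          have h₂ : (n + 1) / 2 = n / 2 + 1 := by omega
          simp [h1, h₁, h₂]

/-- The first pass consumes one digit of each summand per step; when the first summand is used up,
`incWord` carries on through the rest of the second. -/
theorem addWord_bitsWord (m : ℕ) : ∀ (n : ℕ) (c : Bool) (acc : Word),
    addWord (bitsWord m) (bitsWord n, (c, acc)) = acc.reverse ++ bitsWord (m + n + c.toNat) := by
  induction m using Nat.strong_induction_on with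
  | _ m ih =>
    intro n c acc
    by_cases h : m = 0
    · subst h
      rw [Nat.zero_add, ← addFinish_incWord]
      simp [addWord]
    · rw [bitsWord_of_ne_zero h, addWord_cons, isOne_head_bitsWord, tail_bitsWord,
        ih (m / 2) (by omega), bitsWord_of_ne_zero (n := m + n + c.toNat) (by omega),
        List.reverse_cons, List.append_assoc, List.singleton_append]
      congr 2
      · congr 1
        rcases Nat.mod_two_eq_zero_or_one m with hm | hm <;>
        rcases Nat.mod_two_eq_zero_or_one n with hn | hn <;> cases c <;>
        simp [hm, hn, Nat.add_mod]
      · congr 1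
        rcases Nat.mod_two_eq_zero_or_one m with hm | hm <;>
        rcases Nat.mod_two_eq_zero_or_one n with hn | hn <;> cases c <;>
        simp [hm, hn, Bool.atLeastTwo] <;> omega

theorem length_foldl_addStep (v : Word) : ∀ x : Word × (Bool × Word),
    (v.foldl (fun x s => addStep s x) x).1.length ≤ x.1.length ∧
      (v.foldl (fun x s => addStep s x) x).2.2.length = x.2.2.length + v.length := by
  induction v with
  | nil => simp
  | cons s v ih =>
    intro x
    rw [List.foldl_cons]
    obtain ⟨h₁, h₂⟩ := ih (addStep s x)
    refine ⟨h₁.trans ?_, h₂.trans ?_⟩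
    · simp [addStep]
    · simp [addStep]; omega

theorem length_incWord (v : Word) : ∀ x : Bool × Word,
    (incWord v x).2.length = x.2.length + v.length := by
  induction v with
  | nil => simp [incWord]
  | cons s v ih =>
    intro x
    have := ih (carryStep s x)
    rw [incWord] at this ⊢
    rw [List.foldl_cons, this]
    simp [carryStep]; omega

theorem PT.carryStep (s : Sym) : PT (carryStep s) :=
  (PT.fst.bool fun c => isOne (some s) && c).pair
    ((PT.fst.bool fun c => xor (isOne (some s)) c).consBit PT.snd)

theorem PT.addStep (s : Sym) : PT (addStep s) := by
  have h₁ : PT fun x : Word × (Bool × Word) => isOne x.1.head? := (PT.head isOne).comp PT.fst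
  have h₂ : PT fun x : Word × (Bool × Word) => x.2.1 := PT.fst.comp PT.snd
  have h₃ : PT fun x : Word × (Bool × Word) => x.2.2 := PT.snd.comp PT.snd
  exact (PT.tail.comp PT.fst).pair
    ((h₁.bool₂ (fun y c => Bool.atLeastTwo (isOne (some s)) y c) h₂).pair
      ((h₁.bool₂ (fun y c => xor (isOne (some s)) (xor y c)) h₂).consBit h₃))

theorem PT.incWord : PT fun x : Word × (Bool × Word) => incWord x.1 x.2 :=
  PT.foldl (w := fun x : Word × (Bool × Word) => x.1) (init := fun x => x.2)
    (step := FairDensest.carryStep) PT.fst PT.snd PT.carryStep (φ := fun x => 3 * esize x + 3)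
    (((PolyBdd.const _).mul PolyBdd.esize).add (PolyBdd.const _)) (by
      intro x v hv
      have h := length_incWord v x.2
      have h' := hv.length_le
      rw [FairDensest.incWord] at h
      simp only [esize_prod, esize_word, esize_bool]
      rw [h]
      omega)

theorem PT.addFinish : PT addFinish :=
  PT.reverse.comp (PT.fst.ite ((PT.cons Sym.one).comp PT.snd) PT.snd)

theorem PT.addWord : PT fun x : Word × Word => addWord x.1 (x.2, (false, [])) := by
  have := PT.foldl (w := fun x : Word × Word => x.1) (init := fun x => (x.2, (false, ([] : Word))))
    (step := FairDensest.addStep) PT.fst (PT.snd.pair (PT.const _)) PT.addStep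
    (φ := fun x => 3 * esize x + 4)
    (((PolyBdd.const _).mul PolyBdd.esize).add (PolyBdd.const _)) (by
      intro x v hv
      obtain ⟨h₁, h₂⟩ := length_foldl_addStep v (x.2, (false, []))
      have h' := hv.length_le
      simp only [esize_prod, esize_word, esize_bool]
      set y := v.foldl (fun b s => FairDensest.addStep s b) (x.2, (false, ([] : Word)))
      have h₁ : y.1.length ≤ x.2.length := h₁
      have h₂ : y.2.2.length = 0 + v.length := h₂
      omega)
  exact PT.addFinish.comp (PT.incWord.comp this)

theorem PT.binAdd : PT fun x : Bin × Bin => Bin.mk (x.1.val + x.2.val) :=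
  PT.addWord.congr_enc (fun x : Bin × Bin => ((enc x.1 : Word), (enc x.2 : Word))) (fun _ => rfl)
    fun x => by
      have := addWord_bitsWord x.1.val x.2.val false []
      simpa [enc] using this.symm

theorem PT.binSum {n : α → ℕ} {f : α × ℕ → Bin} (hn : PT n) (hf : PT f) :
    PT fun a => Bin.mk (∑ i ∈ Finset.range (n a), (f (a, i)).val) := by
  obtain ⟨ψ, hψ, hle⟩ := PolyBdd.range hn hf
  have key : ∀ (a : α) (i : ℕ),
      (List.range i).foldl (fun b j => Bin.mk (b.val + (f (a, j)).val)) (Bin.mk 0) =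
        Bin.mk (∑ j ∈ Finset.range i, (f (a, j)).val) := by
    intro a i
    induction i with
    | zero => simp
    | succ i ih => simp [List.range_succ, ih, Finset.sum_range_succ]
  have := PT.rangeFold (op := fun x : Bin × Bin => Bin.mk (x.1.val + x.2.val)) (Bin.mk 0) hn hf
    PT.binAdd (φ := fun a => n a + ψ a) ((PolyBdd.of_pT hn).add hψ) (by
      intro a i hi
      rw [key, esize_bin, Nat.size_le]
      have h : ∑ j ∈ Finset.range i, (f (a, j)).val ≤ ∑ j ∈ Finset.range i, 2 ^ ψ a := by
        refine Finset.sum_le_sum fun j hj => (Nat.size_le.1 ?_).le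
        rw [← esize_bin]
        exact hle a j (by have := Finset.mem_range.1 hj; omega)
      rw [Finset.sum_const, Finset.card_range, smul_eq_mul] at h
      -- The crude bound i < 2^i suffices: a sum of at most n numbers of ψ digits has at most n + ψ
      -- digits.
      calc _ ≤ i * 2 ^ ψ a := h
        _ < 2 ^ i * 2 ^ ψ a := by
          have := Nat.lt_two_pow_self (n := i)
          gcongr
        _ ≤ 2 ^ n a * 2 ^ ψ a := by gcongr; omega
        _ = _ := (pow_add _ _ _).symm)
  simpa only [key] using this

/-- Multiplication of a binary number by a unary one. -/
theorem PT.binMul {n : α → ℕ} {f : α → Bin} (hn : PT n) (hf : PT f) :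
    PT fun a => Bin.mk (n a * (f a).val) := by
  have := PT.binSum hn (hf.comp PT.fst)
  simpa using this

/-- The state is the unread rest of the second number and the verdict of the digits read. A more
significant pair of different digits overrides the verdict. -/
def ltStep (s : Sym) (x : Word × Bool) : Word × Bool :=
  (x.1.tail, if xor (isOne (some s)) (isOne x.1.head?) = true then isOne x.1.head? else x.2)

/-- Comparison of binary numbers, from the least significant digit. -/
def ltWord (a : Word) (x : Word × Bool) : Bool :=
  let y := a.foldl (fun x s => ltStep s x) x
  y.1.foldl (fun c s => isOne (some s) || c) y.2

theorem foldl_isOne_bitsWord (n : ℕ) : ∀ c : Bool,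
    (bitsWord n).foldl (fun c s => isOne (some s) || c) c = (decide (0 < n) || c) := by
  induction n using Nat.strong_induction_on with
  | _ n ih =>
    intro c
    by_cases h : n = 0
    · subst h; simp
    · rw [bitsWord_of_ne_zero h, List.foldl_cons, ih (n / 2) (by omega), isOne_bit]
      rcases Nat.mod_two_eq_zero_or_one n with h0 | h1
      · have : 0 < n / 2 := by omega
        have h' : 0 < n := by omega
        simp [this, h', -Nat.div_pos_iff]
      · have h' : 0 < n := by omega
        simp [h1, h']

theorem ltWord_cons (b c : Bool) (w v : Word) :
    ltWord (bit b :: w) (v, c) =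
      ltWord w (v.tail, if xor b (isOne v.head?) = true then isOne v.head? else c) := by
  simp [ltWord, ltStep]

/-- The flag `c` is the verdict of the lower digits, which decides only if the remaining numbers are
equal. -/
theorem ltWord_bitsWord (m : ℕ) : ∀ (n : ℕ) (c : Bool),
    ltWord (bitsWord m) (bitsWord n, c) = decide (m < n ∨ (m = n ∧ c = true)) := by
  induction m using Nat.strong_induction_on with
  | _ m ih =>
    intro n c
    by_cases h : m = 0
    · subst h
      simp only [ltWord, bitsWord_zero, List.foldl_nil, foldl_isOne_bitsWord]
      rcases Nat.eq_zero_or_pos n with rfl | hn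
      · simp
      · simp [hn]
    · rw [bitsWord_of_ne_zero h, ltWord_cons, isOne_head_bitsWord, tail_bitsWord,
        ih (m / 2) (by omega), decide_eq_decide]
      rcases Nat.mod_two_eq_zero_or_one m with hm | hm <;>
      rcases Nat.mod_two_eq_zero_or_one n with hn | hn <;> cases c <;>
      simp [hm, hn] <;> omega

theorem length_foldl_ltStep (v : Word) : ∀ x : Word × Bool,
    (v.foldl (fun x s => ltStep s x) x).1.length ≤ x.1.length := by
  induction v with
  | nil => simp
  | cons s v ih =>
    intro x
    rw [List.foldl_cons]
    refine (ih (ltStep s x)).trans ?_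
    simp [ltStep]

theorem PT.ltStep (s : Sym) : PT (ltStep s) := by
  have h₁ : PT fun x : Word × Bool => isOne x.1.head? := (PT.head isOne).comp PT.fst
  exact (PT.tail.comp PT.fst).pair ((h₁.bool fun y => xor (isOne (some s)) y).ite h₁ PT.snd)

theorem PT.ltWord : PT fun x : Word × Word => ltWord x.1 (x.2, false) := by
  have h := PT.foldl (w := fun x : Word × Word => x.1) (init := fun x => (x.2, false))
    (step := FairDensest.ltStep) PT.fst (PT.snd.pair (PT.const _)) PT.ltStep
    (φ := fun x => 2 * esize x + 2)
    (((PolyBdd.const _).mul PolyBdd.esize).add (PolyBdd.const _)) (by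
      intro x v hv
      have h₁ := length_foldl_ltStep v (x.2, false)
      dsimp only at h₁
      simp only [esize_prod, esize_word, esize_bool]
      omega)
  exact PT.foldl (step := fun s c => isOne (some s) || c) (PT.fst.comp h) (PT.snd.comp h)
    (fun s => PT.id.bool fun c => isOne (some s) || c) (φ := fun _ => 1) (PolyBdd.const 1)
    (by simp)

theorem PT.binLt {f g : α → Bin} (hf : PT f) (hg : PT g) :
    PT fun a => decide ((f a).val < (g a).val) := by
  have : PT fun x : Bin × Bin => decide (x.1.val < x.2.val) :=
    PT.ltWord.congr_enc (fun x : Bin × Bin => ((enc x.1 : Word), (enc x.2 : Word)))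
      (fun _ => rfl) fun x => by
        have := ltWord_bitsWord x.1.val x.2.val false
        simp only [Bool.false_eq_true, and_false, or_false] at this
        exact congrArg enc this.symm
  exact this.comp (hf.pair hg)

/-! ### Reading a sequence of numbers -/

/-- The truth value records whether the first separator has been seen. -/
def takeStep (s : Sym) (x : Bool × Word) : Bool × Word :=
  (x.1 || decide (s = Sym.sep), if (x.1 || decide (s = Sym.sep)) = true then x.2 else s :: x.2)

def dropStep (s : Sym) (x : Bool × Word) : Bool × Word :=
  (x.1 || decide (s = Sym.sep), if x.1 = true then s :: x.2 else x.2)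

/-- The part of a word in front of the first separator. -/
def takeNum (w : Word) : Word := (w.foldl (fun x s => takeStep s x) (false, [])).2.reverse

/-- The part of a word after the first separator. -/
def dropNum (w : Word) : Word := (w.foldl (fun x s => dropStep s x) (false, [])).2.reverse

theorem foldl_takeStep_true (v : Word) (acc : Word) :
    v.foldl (fun x s => takeStep s x) (true, acc) = (true, acc) := by
  induction v with
  | nil => rfl
  | cons s v ih => simpa [takeStep] using ih

theorem foldl_takeStep_false (u : Word) : ∀ acc : Word, Sym.sep ∉ u →
    u.foldl (fun x s => takeStep s x) (false, acc) = (false, u.reverse ++ acc) := by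
  induction u with
  | nil => simp
  | cons s u ih =>
    intro acc h
    rw [List.mem_cons, not_or] at h
    rw [List.foldl_cons, show takeStep s (false, acc) = (false, s :: acc) by
      simp [takeStep, Ne.symm h.1], ih _ h.2]
    simp

theorem takeNum_append {u : Word} (h : Sym.sep ∉ u) (v : Word) :
    takeNum (u ++ Sym.sep :: v) = u := by
  rw [takeNum, List.foldl_append, foldl_takeStep_false u _ h, List.foldl_cons,
    show takeStep Sym.sep (false, u.reverse ++ []) = (true, u.reverse ++ []) by simp [takeStep],
    foldl_takeStep_true]
  simp

theorem foldl_dropStep_true (v : Word) : ∀ acc : Word,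
    v.foldl (fun x s => dropStep s x) (true, acc) = (true, v.reverse ++ acc) := by
  induction v with
  | nil => simp
  | cons s v ih =>
    intro acc
    rw [List.foldl_cons, show dropStep s (true, acc) = (true, s :: acc) by simp [dropStep], ih]
    simp

theorem foldl_dropStep_false (u : Word) : ∀ acc : Word, Sym.sep ∉ u →
    u.foldl (fun x s => dropStep s x) (false, acc) = (false, acc) := by
  induction u with
  | nil => simp
  | cons s u ih =>
    intro acc h
    rw [List.mem_cons, not_or] at h
    rw [List.foldl_cons, show dropStep s (false, acc) = (false, acc) by
      simp [dropStep, Ne.symm h.1], ih _ h.2]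

theorem dropNum_append {u : Word} (h : Sym.sep ∉ u) (v : Word) :
    dropNum (u ++ Sym.sep :: v) = v := by
  rw [dropNum, List.foldl_append, foldl_dropStep_false u _ h, List.foldl_cons,
    show dropStep Sym.sep (false, []) = (true, []) by simp [dropStep], foldl_dropStep_true]
  simp

theorem length_foldl_takeStep (v : Word) : ∀ x : Bool × Word,
    (v.foldl (fun x s => takeStep s x) x).2.length ≤ x.2.length + v.length := by
  induction v with
  | nil => simp
  | cons s v ih =>
    intro x
    rw [List.foldl_cons]
    refine (ih _).trans ?_
    simp only [takeStep]
    split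
    · simp
    · simp; omega

theorem length_foldl_dropStep (v : Word) : ∀ x : Bool × Word,
    (v.foldl (fun x s => dropStep s x) x).2.length ≤ x.2.length + v.length := by
  induction v with
  | nil => simp
  | cons s v ih =>
    intro x
    rw [List.foldl_cons]
    refine (ih _).trans ?_
    simp only [dropStep]
    split
    · simp; omega
    · simp

theorem length_dropNum (w : Word) : (dropNum w).length ≤ w.length := by
  have := length_foldl_dropStep w (false, [])
  simpa [dropNum] using this

theorem PT.takeNum : PT takeNum := by
  refine PT.reverse.comp (PT.snd.comp (PT.foldl (w := fun w : Word => w)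
    (init := fun _ => (false, ([] : Word))) (step := takeStep) PT.id (PT.const _) (fun s => ?_)
    (φ := fun w => 3 + esize w) ((PolyBdd.const _).add PolyBdd.esize) ?_))
  · have h : PT fun x : Bool × Word => x.1 || decide (s = Sym.sep) :=
      PT.fst.bool fun c => c || decide (s = Sym.sep)
    exact h.pair (h.ite PT.snd ((PT.cons s).comp PT.snd))
  · intro w v hv
    rw [esize_prod, esize_bool, esize_word, esize_word]
    refine Nat.add_le_add (by norm_num) ((length_foldl_takeStep v (false, [])).trans ?_)
    simpa using hv.length_le

theorem PT.dropNum : PT dropNum := by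
  refine PT.reverse.comp (PT.snd.comp (PT.foldl (w := fun w : Word => w)
    (init := fun _ => (false, ([] : Word))) (step := dropStep) PT.id (PT.const _) (fun s => ?_)
    (φ := fun w => 3 + esize w) ((PolyBdd.const _).add PolyBdd.esize) ?_))
  · exact (PT.fst.bool fun c => c || decide (s = Sym.sep)).pair
      (PT.fst.ite ((PT.cons s).comp PT.snd) PT.snd)
  · intro w v hv
    rw [esize_prod, esize_bool, esize_word, esize_word]
    refine Nat.add_le_add (by norm_num) ((length_foldl_dropStep v (false, [])).trans ?_)
    simpa using hv.length_le

theorem sep_notMem_bitsWord (n : ℕ) : Sym.sep ∉ bitsWord n := by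
  rw [bitsWord, List.mem_map]
  rintro ⟨b, -, hb⟩
  cases b <;> simp [bit] at hb

theorem encodeNat_eq (n : ℕ) : encodeNat n = bitsWord n ++ [Sym.sep] := rfl

/-- Look up a number in a sequence. -/
theorem takeNum_iterate_dropNum (l : List ℕ) : ∀ i : ℕ,
    takeNum (dropNum^[i] (l.flatMap encodeNat)) = bitsWord (l.getD i 0) := by
  induction l with
  | nil =>
    intro i
    -- Reading past the end yields the empty word, which represents 0 and so agrees with the default
    -- of `getD`.
    have : dropNum^[i] [] = [] := Function.iterate_fixed rfl i
    simp only [List.flatMap_nil, this, List.getD_nil, bitsWord_zero]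
    rfl
  | cons n l ih =>
    intro i
    rw [List.flatMap_cons, encodeNat_eq, List.append_assoc, List.singleton_append]
    cases i with
    | zero => simp [takeNum_append (sep_notMem_bitsWord n)]
    | succ i => rw [Function.iterate_succ_apply, dropNum_append (sep_notMem_bitsWord n), ih]; simp

theorem PT.iterate_dropNum : PT fun x : Word × ℕ => FairDensest.dropNum^[x.2] x.1 := by
  refine PT.iterate PT.snd PT.fst PT.dropNum (φ := fun x => esize x) PolyBdd.esize ?_
  intro x i _
  have : ∀ i, (FairDensest.dropNum^[i] x.1).length ≤ x.1.length := by
    intro i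
    induction i with
    | zero => exact le_rfl
    | succ i ih =>
      rw [Function.iterate_succ_apply']
      exact (length_dropNum _).trans ih
  have := this i
  rw [esize_prod, esize_word, esize_word]
  omega

/-- The symbol at a given position. -/
theorem PT.symAt (F : Option Sym → β) : PT fun x : Word × ℕ => F x.1[x.2]? := by
  have h : PT fun x : Word × ℕ => List.tail^[x.2] x.1 := by
    refine PT.iterate PT.snd PT.fst PT.tail (φ := fun x => esize x) PolyBdd.esize ?_
    intro x i _
    rw [esize_prod, esize_word, esize_word, List.tail_iterate, List.length_drop]
    omega
  refine ((PT.head F).comp h).congr_enc (fun a => a) (fun _ => rfl) fun x => ?_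
  rw [List.tail_iterate, List.head?_drop]

/-! ### Access to the input graph -/

instance : Enc WGraph := ⟨encodeGraph⟩

namespace WGraph

/-- The numerator of a weight, `0` outside of the graph. -/
def entry (G : WGraph) (u v : ℕ) : ℕ :=
  if h : u < G.n ∧ v < G.n then G.num ⟨u, h.1⟩ ⟨v, h.2⟩ else 0

theorem entry_fin (G : WGraph) (u v : Fin G.n) : G.entry u v = G.num u v := by
  simp [entry]

theorem entry_comm (G : WGraph) (u v : ℕ) : G.entry u v = G.entry v u := by
  unfold entry
  by_cases h : u < G.n ∧ v < G.n
  · rw [dif_pos h, dif_pos h.symm, G.symm]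
  · rw [dif_neg h, dif_neg fun h' => h h'.symm]

theorem entry_self (G : WGraph) (u : ℕ) : G.entry u u = 0 := by
  unfold entry
  split
  · exact G.loopless _
  · rfl

/-- The numbers in the encoding of a graph. -/
def stream (G : WGraph) : List ℕ :=
  G.den :: (List.ofFn fun u => List.ofFn fun v => G.num u v).flatten

theorem encodeWeights_eq (G : WGraph) : encodeWeights G = G.stream.flatMap encodeNat := by
  rw [encodeWeights, stream, List.flatMap_cons, List.flatMap_def, List.map_flatten,
    List.flatten_flatten, List.map_map, List.map_ofFn]
  congr 3
  funext u
  simp [List.map_ofFn, Function.comp_def]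

/-- The matrix is stored row by row; the shift by one accounts for the denominator in front. -/
theorem stream_getD (G : WGraph) {u v : ℕ} (hu : u < G.n) (hv : v < G.n) :
    G.stream.getD (u * G.n + v + 1) 0 = G.entry u v := by
  have h : (List.ofFn fun u => List.ofFn fun v => G.num u v).flatten =
      List.ofFn fun i : Fin (G.n * G.n) => G.entry (i / G.n) (i % G.n) := by
    rw [List.ofFn_mul]
    congr 2
    funext u
    congr 1
    funext v
    have hn : 0 < G.n := u.pos
    have h₁ : (u * G.n + v : ℕ) / G.n = u := by
      rw [Nat.mul_comm, Nat.mul_add_div hn, Nat.div_eq_of_lt v.2, Nat.add_zero]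
    have h₂ : (u * G.n + v : ℕ) % G.n = v := by
      rw [Nat.mul_comm, Nat.mul_add_mod, Nat.mod_eq_of_lt v.2]
    simp only [h₁, h₂, entry_fin]
  have hlt : u * G.n + v < G.n * G.n := by nlinarith
  have hn : 0 < G.n := by omega
  have h₁ : (u * G.n + v) / G.n = u := by
    rw [Nat.mul_comm, Nat.mul_add_div hn, Nat.div_eq_of_lt hv, Nat.add_zero]
  have h₂ : (u * G.n + v) % G.n = v := by
    rw [Nat.mul_comm, Nat.mul_add_mod, Nat.mod_eq_of_lt hv]
  rw [stream, List.getD_cons_succ, h, List.getD_eq_getElem _ _ (by simpa using hlt)]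
  simp [h₁, h₂]

theorem sep_notMem_replicate (n : ℕ) : Sym.sep ∉ List.replicate n Sym.one := by
  simp [List.mem_replicate]

end WGraph

open WGraph

theorem PT.vertices : PT fun G : WGraph => G.n :=
  PT.takeNum.congr_enc (fun G : WGraph => (enc G : Word)) (fun _ => rfl) fun G => by
    change List.replicate G.n Sym.one =
      FairDensest.takeNum (List.replicate G.n Sym.one ++ [Sym.sep] ++ encodeWeights G)
    rw [List.append_assoc, List.singleton_append, takeNum_append (sep_notMem_replicate _)]

theorem PT.stream : PT fun x : WGraph × ℕ => Bin.mk (x.1.stream.getD x.2 0) := by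
  -- The extra `dropNum` skips the vertex list, which is also closed by a separator.
  have h : PT fun x : Word × ℕ => FairDensest.takeNum (FairDensest.dropNum^[x.2 + 1] x.1) :=
    PT.takeNum.comp (PT.iterate_dropNum.comp (PT.fst.pair (PT.succ.comp PT.snd)))
  refine h.congr_enc (fun x : WGraph × ℕ => ((enc x.1 : Word), x.2)) (fun _ => rfl) fun x => ?_
  change bitsWord _ = FairDensest.takeNum (FairDensest.dropNum^[x.2 + 1]
    (List.replicate x.1.n Sym.one ++ [Sym.sep] ++ encodeWeights x.1))
  rw [List.append_assoc, List.singleton_append, Function.iterate_succ_apply,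
    dropNum_append (sep_notMem_replicate _), encodeWeights_eq, takeNum_iterate_dropNum]

theorem PT.entry {G : α → WGraph} {u v : α → ℕ} (hG : PT G) (hu : PT u) (hv : PT v) :
    PT fun a => Bin.mk ((G a).entry (u a) (v a)) := by
  have hn := PT.vertices.comp hG
  have h := ((hu.natLt hn).bool₂ (fun x y => x && y) (hv.natLt hn)).ite
    (PT.stream.comp (hG.pair (PT.succ.comp (PT.natAdd.comp ((PT.natMul.comp (hu.pair hn)).pair hv)))))
    (PT.const (Bin.mk 0))
  refine h.congr_enc (fun a => a) (fun _ => rfl) fun a => ?_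
  congr 1
  by_cases h : u a < (G a).n ∧ v a < (G a).n
  · simpa [h] using (stream_getD (G a) h.1 h.2).symm
  · have h' : (decide (u a < (G a).n) && decide (v a < (G a).n)) = false := by
      simpa using h
    simp only [h', WGraph.entry, dif_neg h]
    simp

/-! ### The reduction as a computation -/

namespace WGraph

/-- The common degree of a regular graph, as the numerator. -/
def rowSum (G : WGraph) : ℕ := ∑ v ∈ Finset.range G.n, G.entry 0 v

/-- The weights of the constructed graph: the first `n` vertices carry the given graph, scaled by
`k - 1`, and the next `k` vertices form a clique with the same total weighted degree. -/
def outNum (G : WGraph) (k u v : ℕ) : ℕ :=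
  if ((G.n ≤ u ∧ u < G.n + k) ∧ (G.n ≤ v ∧ v < G.n + k)) ∧ u ≠ v then G.rowSum
  else (k - 1) * G.entry u v

/-- The graph that results from the reduction. -/
def out (G : WGraph) (k : ℕ) : WGraph where
  n := G.n + G.n
  num u v := G.outNum k u v
  den := 1
  den_pos := one_pos
  symm u v := by
    unfold outNum
    rw [entry_comm]
    congr 1
    rw [ne_comm, and_comm (a := (G.n ≤ (u : ℕ) ∧ (u : ℕ) < G.n + k))]
  loopless u := by simp [outNum, entry_self]

/-- The added vertices are red. -/
def outRed (G : WGraph) (k : ℕ) (v : Fin (G.out k).n) : Bool := decide (G.n ≤ v)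

/-- The total weight, in both directions, of the set with the indicator vector `y`. -/
def wordWeight (G : WGraph) (k : ℕ) (y : Word) : ℕ :=
  ∑ u ∈ Finset.range (G.n + G.n), ∑ v ∈ Finset.range (G.n + G.n),
    if (isOne y[u]? && isOne y[v]?) = true then G.outNum k u v else 0

/-- The number of vertices below `m` in the set with the indicator vector `y`. -/
def wordCard (m : ℕ) (y : Word) : ℕ := ((Finset.range m).filter fun u => isOne y[u]? = true).card

/-- Whether the density of the set with the indicator vector `y` exceeds the fraction
`(N + 2) / (2 * N)` of the weighted degree. -/
def isDense (G : WGraph) (N k : ℕ) (y : Word) : Bool :=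
  decide ((N + 2) * (wordCard (G.n + G.n) y * ((k - 1) * G.rowSum)) < 2 * N * G.wordWeight k y)

end WGraph

theorem flatten_ofFn {α : Type*} {m : ℕ} (f : ℕ → List α) :
    (List.ofFn fun v : Fin m => f v).flatten = (List.range m).flatMap f := by
  rw [List.flatMap_def, ← List.map_coe_finRange_eq_range, List.map_map, List.ofFn_eq_map]
  rfl

/-- Written with ranges of natural numbers, the encoding falls under `PT.flatMap`. -/
theorem encodeColored_out (G : WGraph) (k : ℕ) : encodeColored (G.out k) (G.outRed k) =
    ((List.range (G.n + G.n)).flatMap fun v => [bit (decide (G.n ≤ v))]) ++ ([Sym.sep] ++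
      (encodeNat 1 ++ (List.range (G.n + G.n)).flatMap fun u =>
        (List.range (G.n + G.n)).flatMap fun v => encodeNat (G.outNum k u v))) := by
  rw [encodeColored, encodeWeights, List.append_assoc]
  congr 1
  · rw [← flatten_ofFn, List.ofFn_eq_map, List.ofFn_eq_map, ← List.flatMap_def,
      ← List.map_eq_flatMap]
    rfl
  · congr 2
    rw [← flatten_ofFn]
    congr 2
    funext u
    rw [← flatten_ofFn]
    rfl

theorem PT.rowSum {G : α → WGraph} (hG : PT G) : PT fun a => Bin.mk (G a).rowSum :=
  PT.binSum (f := fun x : α × ℕ => Bin.mk ((G x.1).entry 0 x.2)) (PT.vertices.comp hG)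
    (PT.entry (hG.comp PT.fst) (PT.const 0) PT.snd)

theorem PT.outNum {G : α → WGraph} {k u v : α → ℕ} (hG : PT G) (hk : PT k) (hu : PT u)
    (hv : PT v) : PT fun a => Bin.mk ((G a).outNum (k a) (u a) (v a)) := by
  have hn := PT.vertices.comp hG
  have hnk := PT.natAdd.comp (hn.pair hk)
  have h₁ := (hu.natLt hn).bool₂ (fun x y => !x && y) (hu.natLt hnk)
  have h₂ := (hv.natLt hn).bool₂ (fun x y => !x && y) (hv.natLt hnk)
  have h := (h₁.bool₃ (fun x y z => (x && y) && !z) h₂ (hu.natEq hv)).ite (PT.rowSum hG)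
    (PT.binMul (PT.pred.comp hk) (PT.entry hG hu hv))
  refine h.congr_enc (fun a => a) (fun _ => rfl) fun a => ?_
  congr 1
  simp only [WGraph.outNum, Bool.and_eq_true, Bool.not_eq_true', decide_eq_false_iff_not,
    decide_eq_true_eq, not_lt, Nat.pred_eq_sub_one]
  split <;> rfl

theorem PT.encodeNat {f : α → Bin} (hf : PT f) : PT fun a => FairDensest.encodeNat (f a).val := by
  have : PT fun a => (enc (f a) : Word) := hf.congr_enc (fun a => a) (fun _ => rfl) fun _ => rfl
  exact PT.append.comp (this.pair (PT.const [Sym.sep]))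

theorem PT.encodeColored_out {k : ℕ → ℕ} (hk : PT k) :
    PT fun G : WGraph => encodeColored (G.out (k G.n)) (G.outRed (k G.n)) := by
  have h2 : PT fun G : WGraph => G.n + G.n := PT.natAdd.comp (PT.vertices.pair PT.vertices)
  have h₁ : PT fun G : WGraph => (List.range (G.n + G.n)).flatMap fun v =>
      [bit (decide (G.n ≤ v))] := by
    refine PT.flatMap (f := fun x : WGraph × ℕ => [bit (decide (x.1.n ≤ x.2))]) h2 ?_
    have := PT.bool (fun b => [bit !b]) (PT.snd.natLt (PT.vertices.comp (PT.fst (β := ℕ))))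
    refine this.congr_enc (fun a => a) (fun _ => rfl) fun a => ?_
    rw [← decide_not]
    simp only [not_lt]
  have hG : PT fun x : (WGraph × ℕ) × ℕ => x.1.1 := PT.fst.comp PT.fst
  have h₂ : PT fun G : WGraph => (List.range (G.n + G.n)).flatMap fun u =>
      (List.range (G.n + G.n)).flatMap fun v => FairDensest.encodeNat (G.outNum (k G.n) u v) :=
    PT.flatMap h2 (PT.flatMap (h2.comp PT.fst) (PT.encodeNat
      (PT.outNum hG (hk.comp (PT.vertices.comp hG)) (PT.snd.comp PT.fst) PT.snd)))
  have h := PT.append.comp (h₁.pair (PT.append.comp ((PT.const [Sym.sep]).pair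
    (PT.append.comp ((PT.const (FairDensest.encodeNat 1)).pair h₂)))))
  simpa only [FairDensest.encodeColored_out] using h

theorem PT.isDense (N : ℕ) {k : ℕ → ℕ} (hk : PT k) :
    PT fun x : WGraph × Word => x.1.isDense N (k x.1.n) x.2 := by
  have hn : PT fun x : WGraph × Word => x.1.n := PT.vertices.comp PT.fst
  have hkn : PT fun x : WGraph × Word => k x.1.n := hk.comp hn
  have h2 : PT fun x : WGraph × Word => x.1.n + x.1.n := PT.natAdd.comp (hn.pair hn)
  have hc : PT fun x : WGraph × Word => wordCard (x.1.n + x.1.n) x.2 :=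
    PT.count h2 ((PT.symAt isOne).comp ((PT.snd.comp PT.fst).pair PT.snd))
  have hx : PT fun x : ((WGraph × Word) × ℕ) × ℕ => x.1.1 := PT.fst.comp PT.fst
  have hu : PT fun x : ((WGraph × Word) × ℕ) × ℕ => x.1.2 := PT.snd.comp PT.fst
  have hw : PT fun x : WGraph × Word => Bin.mk (x.1.wordWeight (k x.1.n) x.2) := by
    have h₁ : PT fun x : ((WGraph × Word) × ℕ) × ℕ => isOne x.1.1.2[x.1.2]? :=
      (PT.symAt isOne).comp ((PT.snd.comp hx).pair hu)
    have h₂ : PT fun x : ((WGraph × Word) × ℕ) × ℕ => isOne x.1.1.2[x.2]? :=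
      (PT.symAt isOne).comp ((PT.snd.comp hx).pair PT.snd)
    have h₃ := (h₁.bool₂ (fun x y => x && y) h₂).ite
      (PT.outNum (PT.fst.comp hx) (hkn.comp hx) hu PT.snd) (PT.const (Bin.mk 0))
    have h₄ := PT.binSum h2 (PT.binSum (h2.comp PT.fst) h₃)
    refine h₄.congr_enc (fun a => a) (fun _ => rfl) fun a => ?_
    congr 2
    refine Finset.sum_congr rfl fun u _ => Finset.sum_congr rfl fun v _ => ?_
    simp only [apply_ite Bin.val]
  exact PT.binLt (PT.binMul (PT.const (N + 2)) (PT.binMul hc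
    (PT.binMul (PT.pred.comp hkn) (PT.rowSum PT.fst)))) (PT.binMul (PT.const (2 * N)) hw)

/-! ### The size of the small sets -/

/-- The number `δ * n` is computable from `n`, where it is an integer. -/
theorem exists_pT_size {δ : ℝ} (h1 : δ < 1) : ∃ (k : ℕ → ℕ) (valid : ℕ → Bool),
    PT k ∧ PT valid ∧ ∀ n, 0 < n → (valid n = true → (k n : ℝ) = δ * n) ∧
      (valid n = false → ∀ j : ℕ, (j : ℝ) ≠ δ * n) := by
  -- Either δ is a fraction a/b of natural numbers, whose terms become constants of the program, or
  -- δn is never a natural number for positive n.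
  by_cases hδ : ∃ a b : ℕ, 0 < b ∧ δ * b = a
  · obtain ⟨a, b, hb, hab⟩ := hδ
    have hb' : (0 : ℝ) < b := by exact_mod_cast hb
    -- Counting the j < n with bj < an replaces division: when an/b is an integer, it is at most n
    -- because δ < 1, and the count equals it.
    have hk : PT fun n : ℕ =>
        ((Finset.range n).filter fun j => decide (b * j < a * n) = true).card :=
      PT.count (c := fun x : ℕ × ℕ => decide (b * x.2 < a * x.1)) PT.id
        (PT.natLt (PT.natMul.comp ((PT.const b).pair PT.snd))
          (PT.natMul.comp ((PT.const a).pair PT.fst)))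
    refine ⟨_, _, hk, PT.natEq (PT.natMul.comp ((PT.const b).pair hk))
      (PT.natMul.comp ((PT.const a).pair PT.id)), fun n hn => ⟨fun h => ?_, fun h j hj => ?_⟩⟩
    · have h' := of_decide_eq_true h
      have h'' := congrArg (Nat.cast : ℕ → ℝ) h'
      rw [Nat.cast_mul, Nat.cast_mul, ← hab] at h''
      apply mul_left_cancel₀ hb'.ne'
      rw [h'']
      ring
    · have h₁ : b * j = a * n := by
        have : (b : ℝ) * j = a * n := by rw [hj, ← hab]; ring
        exact_mod_cast this
      have hn' : (0 : ℝ) < n := by exact_mod_cast hn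
      have h₂ : j < n := by
        have : (j : ℝ) < n := by rw [hj]; nlinarith
        exact_mod_cast this
      have h₃ : ((Finset.range n).filter fun i => decide (b * i < a * n) = true) =
          Finset.range j := by
        ext i
        rw [Finset.mem_filter, Finset.mem_range, Finset.mem_range, decide_eq_true_eq, ← h₁,
          Nat.mul_lt_mul_left hb]
        omega
      have h₄ := of_decide_eq_false h
      rw [h₃, Finset.card_range] at h₄
      exact h₄ h₁
  · refine ⟨fun _ => 0, fun _ => false, PT.const 0, PT.const false, fun n hn =>
      ⟨fun h => by simp at h, fun _ j hj => hδ ⟨j, n, hn, hj.symm⟩⟩⟩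

/-! ### Induced weight in regular graphs -/

section Inner

variable {V : Type*}

/-- The total weight inside `S`, each edge counted in both directions. -/
def inner (w : V → V → ℝ) (S : Finset V) : ℝ := ∑ u ∈ S, ∑ v ∈ S, w u v

variable {w : V → V → ℝ}

theorem inner_nonneg (h0 : ∀ u v, 0 ≤ w u v) (S : Finset V) : 0 ≤ inner w S :=
  Finset.sum_nonneg fun _ _ => Finset.sum_nonneg fun _ _ => h0 _ _

theorem inner_mono (h0 : ∀ u v, 0 ≤ w u v) {S T : Finset V} (h : S ⊆ T) :
    inner w S ≤ inner w T :=
  (Finset.sum_le_sum fun _ _ => Finset.sum_le_sum_of_subset_of_nonneg h fun _ _ _ => h0 _ _).trans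
    (Finset.sum_le_sum_of_subset_of_nonneg h fun _ _ _ => Finset.sum_nonneg fun _ _ => h0 _ _)

theorem inner_le_degree (h0 : ∀ u v, 0 ≤ w u v) {R S : Finset V} {D : ℝ}
    (hD : ∀ u ∈ R, ∑ v ∈ R, w u v = D) (h : S ⊆ R) : inner w S ≤ D * S.card := by
  calc inner w S ≤ ∑ u ∈ S, D := Finset.sum_le_sum fun u hu => by
        rw [← hD u (h hu)]
        exact Finset.sum_le_sum_of_subset_of_nonneg h fun _ _ _ => h0 _ _
    _ = D * S.card := by rw [Finset.sum_const, nsmul_eq_mul, mul_comm]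

/-- Deleting x removes its row and its column; they have equal sums by symmetry and share only a
zero diagonal entry. -/
theorem inner_erase [DecidableEq V] (hs : ∀ u v, w u v = w v u) (hl : ∀ u, w u u = 0)
    {S : Finset V} {x : V} (hx : x ∈ S) :
    inner w (S.erase x) = inner w S - 2 * ∑ v ∈ S, w x v := by
  have h₁ : ∀ u, ∑ v ∈ S, w u v = w u x + ∑ v ∈ S.erase x, w u v := fun u =>
    (Finset.add_sum_erase S (fun v => w u v) hx).symm
  have h₂ : inner w S = ∑ v ∈ S, w x v + ∑ u ∈ S.erase x, ∑ v ∈ S, w u v :=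
    (Finset.add_sum_erase S (fun u => ∑ v ∈ S, w u v) hx).symm
  have h₃ : ∑ u ∈ S.erase x, w u x = ∑ v ∈ S, w x v := by
    rw [h₁ x, hl, zero_add]
    exact Finset.sum_congr rfl fun u _ => hs u x
  rw [h₂, Finset.sum_congr rfl fun u _ => h₁ u, Finset.sum_add_distrib, h₃, inner]
  ring

/-- Removing a vertex of least degree does not decrease the edge density. -/
theorem exists_inner_erase [DecidableEq V] (hs : ∀ u v, w u v = w v u) (hl : ∀ u, w u u = 0)
    {S : Finset V} (hS : S.Nonempty) :
    ∃ x ∈ S, inner w S * ((S.card : ℝ) - 2) ≤ S.card * inner w (S.erase x) := by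
  -- The average degree inside S is `inner w S / S.card`; some x has at most this degree, and its
  -- deletion costs twice its degree.
  obtain ⟨x, hx, hle⟩ := Finset.exists_le_of_sum_le hS
    (f := fun u => ∑ v ∈ S, w u v) (g := fun _ => inner w S / S.card) (by
      have : (S.card : ℝ) ≠ 0 := by exact_mod_cast hS.card_pos.ne'
      rw [Finset.sum_const, nsmul_eq_mul, mul_div_cancel₀ _ this, inner])
  refine ⟨x, hx, ?_⟩
  have hc : (0 : ℝ) < S.card := by exact_mod_cast hS.card_pos
  rw [le_div_iff₀ hc] at hle
  rw [inner_erase hs hl hx]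
  nlinarith

/-- If all `k`-sets are sparse, so are all larger sets. -/
theorem inner_le_of_card_ge [DecidableEq V] (hs : ∀ u v, w u v = w v u) (hl : ∀ u, w u u = 0)
    {R : Finset V} {k : ℕ} (hk : 2 ≤ k) {c : ℝ}
    (hno : ∀ S ⊆ R, S.card = k → inner w S ≤ c * k) :
    ∀ m : ℕ, k ≤ m → ∀ S ⊆ R, S.card = m → inner w S * ((k : ℝ) - 1) ≤ c * (m * ((m : ℝ) - 1)) := by
  have hk' : (2 : ℝ) ≤ k := by exact_mod_cast hk
  intro m hm
  induction m, hm using Nat.le_induction with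
  | base =>
    intro S hS hc
    have := hno S hS hc
    nlinarith
  | succ m hm ih =>
    intro S hS hc
    have hm' : (2 : ℝ) ≤ m := by exact_mod_cast hk.trans hm
    obtain ⟨x, hx, hle⟩ := exists_inner_erase (w := w) hs hl
      (Finset.card_pos.1 (by omega : 0 < S.card))
    have h := ih (S.erase x) ((Finset.erase_subset _ _).trans hS)
      (by rw [Finset.card_erase_of_mem hx]; omega)
    rw [hc] at hle
    push_cast at hle ⊢
    -- Here S has m + 1 elements, so `hle` bounds (m - 1) times its weight; the factor m - 1 is
    -- positive and is cancelled afterwards.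
    have h₁ : (inner w S * ((k : ℝ) - 1)) * ((m : ℝ) - 1) ≤
        (c * (((m : ℝ) + 1) * (m + 1 - 1))) * ((m : ℝ) - 1) := by
      have h₂ := mul_le_mul_of_nonneg_right hle (by linarith : (0 : ℝ) ≤ (k : ℝ) - 1)
      have h₃ := mul_le_mul_of_nonneg_left h (by linarith : (0 : ℝ) ≤ (m : ℝ) + 1)
      nlinarith
    exact le_of_mul_le_mul_right h₁ (by linarith)

/-- If all `k`-sets are sparse, then no set together with an equally large part of a `k`-clique is
much denser than half of the degree. -/
theorem inner_add_clique_le [DecidableEq V] (h0 : ∀ u v, 0 ≤ w u v) (hs : ∀ u v, w u v = w v u)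
    (hl : ∀ u, w u u = 0) {R : Finset V} {D η : ℝ} (hD0 : 0 ≤ D) (hη : 0 ≤ η)
    (hD : ∀ u ∈ R, ∑ v ∈ R, w u v = D) {k : ℕ} (hk : 1 ≤ k) (hkR : k ≤ R.card)
    (hno : ∀ S ⊆ R, S.card = k → inner w S ≤ η * D * k) {S : Finset V} (hS : S ⊆ R) {a : ℕ}
    (hak : a ≤ k) (haS : a ≤ S.card) :
    ((k : ℝ) - 1) * inner w S + D * (a * ((a : ℝ) - 1)) ≤
      (1 + 2 * η) * (D * (((k : ℝ) - 1) * S.card)) := by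
  rcases Nat.eq_zero_or_pos a with rfl | ha
  · have h₁ := inner_le_degree h0 hD hS
    have hk' : (1 : ℝ) ≤ k := by exact_mod_cast hk
    have h₂ : (0 : ℝ) ≤ D * (((k : ℝ) - 1) * S.card) :=
      mul_nonneg hD0 (mul_nonneg (by linarith) (Nat.cast_nonneg _))
    have h₃ := mul_le_mul_of_nonneg_left h₁ (by linarith : (0 : ℝ) ≤ (k : ℝ) - 1)
    have h₄ := mul_nonneg hη h₂
    simp only [Nat.cast_zero, zero_mul, mul_zero, add_zero]
    nlinarith
  -- For k = 1 the clique has no edges and the scaling factor k - 1 is zero: both sides vanish.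
  rcases Nat.eq_or_lt_of_le hk with rfl | hk2
  · have : a = 1 := by omega
    subst this
    simp
  have hx0 := inner_nonneg h0 S
  have hxD := inner_le_degree h0 hD hS
  set x := inner w S
  obtain ⟨m, hm⟩ : ∃ m, m = S.card := ⟨_, rfl⟩
  rw [← hm] at haS hxD ⊢
  have hk' : (2 : ℝ) ≤ k := by exact_mod_cast hk2
  have ha' : (1 : ℝ) ≤ a := by exact_mod_cast ha
  have hak' : (a : ℝ) ≤ k := by exact_mod_cast hak
  have ham' : (a : ℝ) ≤ m := by exact_mod_cast haS
  rcases le_total k m with hkm | hmk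
  · have hkm' : (k : ℝ) ≤ m := by exact_mod_cast hkm
    -- If k ≤ 2ηm, the degree bound x ≤ Dm suffices. Otherwise k ≤ 2(k - 1) turns sparsity into kx ≤
    -- 2ηDm², which is where the 2 in 1 + 2η arises, and the claim reduces to (m - k)(k - 2ηm) ≥ 0.
    have h₁ : x + D * k ≤ (1 + 2 * η) * (D * m) := by
      rcases le_total (k : ℝ) (2 * η * m) with h | h
      · have := mul_le_mul_of_nonneg_left h hD0
        nlinarith
      · have h₂ : x * ((k : ℝ) - 1) ≤ η * D * (m * ((m : ℝ) - 1)) :=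
          inner_le_of_card_ge hs hl hk2 hno m hkm S hS hm.symm
        have h₃ : k * x ≤ 2 * (η * D) * (m * m) := by
          have : 0 ≤ η * D * m := mul_nonneg (mul_nonneg hη hD0) (by linarith)
          have : 0 ≤ x * ((k : ℝ) - 2) := mul_nonneg hx0 (by linarith)
          nlinarith
        have h₄ : 0 ≤ D * (((m : ℝ) - k) * (k - 2 * η * m)) :=
          mul_nonneg hD0 (mul_nonneg (by linarith) (by linarith))
        have h₅ : k * (x + D * k) ≤ k * ((1 + 2 * η) * (D * m)) := by nlinarith
        exact le_of_mul_le_mul_left h₅ (by linarith)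
    have h₂ : (a : ℝ) * ((a : ℝ) - 1) ≤ k * ((k : ℝ) - 1) :=
      mul_le_mul hak' (by linarith) (by linarith) (by linarith)
    have h₃ := mul_le_mul_of_nonneg_left h₂ hD0
    have h₄ := mul_le_mul_of_nonneg_left h₁ (by linarith : (0 : ℝ) ≤ (k : ℝ) - 1)
    nlinarith
  · have hmk' : (m : ℝ) ≤ k := by exact_mod_cast hmk
    -- If m ≤ ηk, the degree bound suffices. Otherwise S is enlarged to a k-set, so x ≤ ηDk, and the
    -- claim reduces to (k - m)(m - ηk) ≥ 0.
    have h₁ : k * x + D * (m * m) ≤ (1 + η) * (D * (m * k)) := by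
      rcases le_total (m : ℝ) (η * k) with h | h
      · have h₂ := mul_le_mul_of_nonneg_left hxD (by linarith : (0 : ℝ) ≤ k)
        have h₃ := mul_le_mul_of_nonneg_left h (mul_nonneg hD0 (by linarith : (0 : ℝ) ≤ m))
        nlinarith
      · obtain ⟨T, hST, hTR, hT⟩ := Finset.exists_subsuperset_card_eq hS (hm ▸ hmk) hkR
        have h₂ := (inner_mono h0 hST).trans (hno T hTR hT)
        have h₃ := mul_le_mul_of_nonneg_left h₂ (by linarith : (0 : ℝ) ≤ k)
        have h₄ : 0 ≤ D * (((k : ℝ) - m) * (m - η * k)) :=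
          mul_nonneg hD0 (mul_nonneg (by linarith) (by linarith))
        nlinarith
    have h₂ : (a : ℝ) * ((a : ℝ) - 1) ≤ m * ((m : ℝ) - 1) :=
      mul_le_mul ham' (by linarith) (by linarith) (by linarith)
    -- This trades the clique count m(m - 1) against m², using m ≤ k.
    have h₃ : k * (m * ((m : ℝ) - 1)) ≤ (k - 1) * (m * m) := by nlinarith
    have h₄ := mul_le_mul_of_nonneg_left h₂ hD0
    have h₅ := mul_le_mul_of_nonneg_left h₃ hD0
    have h₆ := mul_le_mul_of_nonneg_left h₁ (by linarith : (0 : ℝ) ≤ (k : ℝ) - 1)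
    have h₇ : 0 ≤ η * (D * (((k : ℝ) - 1) * (m * k))) :=
      mul_nonneg hη (mul_nonneg hD0 (mul_nonneg (by linarith) (by nlinarith)))
    have h₈ : k * (((k : ℝ) - 1) * x + D * (a * ((a : ℝ) - 1))) ≤
        k * ((1 + 2 * η) * (D * (((k : ℝ) - 1) * m))) := by nlinarith
    exact le_of_mul_le_mul_left h₈ (by linarith)

end Inner

/-! ### Expansion and density -/

namespace WGraph

/-- The numerators of the weights, as real numbers. -/
def realEntry (G : WGraph) (u v : ℕ) : ℝ := G.entry u v

theorem realEntry_nonneg (G : WGraph) (u v : ℕ) : 0 ≤ G.realEntry u v := Nat.cast_nonneg _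

theorem realEntry_comm (G : WGraph) (u v : ℕ) : G.realEntry u v = G.realEntry v u := by
  rw [realEntry, entry_comm, realEntry]

theorem realEntry_self (G : WGraph) (u : ℕ) : G.realEntry u u = 0 := by
  rw [realEntry, entry_self, Nat.cast_zero]

theorem sum_realEntry {G : WGraph} {d : ℝ} (hG : G.IsRegular d) {u : ℕ}
    (hu : u ∈ Finset.range G.n) : ∑ v ∈ Finset.range G.n, G.realEntry u v = G.den * d := by
  have hden : (G.den : ℝ) ≠ 0 := by exact_mod_cast G.den_pos.ne'
  rw [Finset.sum_range, ← hG ⟨u, Finset.mem_range.1 hu⟩, Finset.mul_sum]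
  refine Finset.sum_congr rfl fun v _ => ?_
  rw [weight, mul_div_cancel₀ _ hden, realEntry, ← entry_fin]

theorem rowSum_eq {G : WGraph} {d : ℝ} (hG : G.IsRegular d) (hn : 0 < G.n) :
    (G.rowSum : ℝ) = G.den * d := by
  rw [← sum_realEntry hG (Finset.mem_range.2 hn), rowSum, Nat.cast_sum]
  rfl

theorem inner_map_val {m : ℕ} (w : ℕ → ℕ → ℝ) (S : Finset (Fin m)) :
    inner w (S.map Fin.valEmbedding) = ∑ u ∈ S, ∑ v ∈ S, w u v := by
  simp [inner]

/-- In a regular graph, the weight that leaves a set is the complement of the weight inside. -/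
theorem expansion_eq {G : WGraph} {d : ℝ} (hG : G.IsRegular d) (hd : 0 < d)
    {S : Finset (Fin G.n)} (hS : S.Nonempty) :
    G.expansion d S = 1 - inner G.realEntry (S.map Fin.valEmbedding) / (G.den * d * S.card) := by
  have hden : (G.den : ℝ) ≠ 0 := by exact_mod_cast G.den_pos.ne'
  have hc : (S.card : ℝ) ≠ 0 := by exact_mod_cast hS.card_pos.ne'
  have h₁ : ∀ u, ∑ v ∈ Sᶜ, G.weight u v = d - ∑ v ∈ S, G.weight u v := by
    intro u
    rw [← hG u, ← Finset.sum_add_sum_compl S]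
    ring
  have h₂ : inner G.realEntry (S.map Fin.valEmbedding) =
      G.den * ∑ u ∈ S, ∑ v ∈ S, G.weight u v := by
    rw [inner_map_val, Finset.mul_sum]
    refine Finset.sum_congr rfl fun u _ => ?_
    rw [Finset.mul_sum]
    refine Finset.sum_congr rfl fun v _ => ?_
    rw [weight, mul_div_cancel₀ _ hden, realEntry, entry_fin]
  rw [expansion, Finset.sum_congr rfl fun u _ => h₁ u, Finset.sum_sub_distrib, Finset.sum_const,
    nsmul_eq_mul, h₂]
  field_simp

/-- The total weight of a set of vertices of the constructed graph. -/
theorem inner_outNum (G : WGraph) {k : ℕ} (hk : 1 ≤ k) (T : Finset ℕ) :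
    inner (fun u v => (G.outNum k u v : ℝ)) T =
      ((k : ℝ) - 1) * inner G.realEntry (T.filter (· < G.n)) +
        G.rowSum * (((T.filter fun u => G.n ≤ u ∧ u < G.n + k).card : ℝ) *
          (((T.filter fun u => G.n ≤ u ∧ u < G.n + k).card : ℝ) - 1)) := by
  set A := T.filter fun u => G.n ≤ u ∧ u < G.n + k with hA
  -- The clique is written as the full block A × A minus its diagonal, which sums to |A|² - |A|.
  -- Entries of G vanish on this block, so the two kinds of weight simply add.
  have h₁ : ∀ u ∈ T, ∀ v ∈ T, (G.outNum k u v : ℝ) = ((k : ℝ) - 1) * G.realEntry u v +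
      ((if u ∈ A then (if v ∈ A then (G.rowSum : ℝ) else 0) else 0) -
        if u ∈ A then (if u = v then (G.rowSum : ℝ) else 0) else 0) := by
    intro u hu v hv
    have hk' : ((k - 1 : ℕ) : ℝ) = (k : ℝ) - 1 := by rw [Nat.cast_sub hk, Nat.cast_one]
    have hu' : u ∈ A ↔ G.n ≤ u ∧ u < G.n + k := by simp [hA, hu]
    have hv' : v ∈ A ↔ G.n ≤ v ∧ v < G.n + k := by simp [hA, hv]
    have h0 : u ∈ A → G.entry u v = 0 := by
      intro h
      rw [entry, dif_neg]
      rw [hu'] at h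
      omega
    simp only [outNum, ← hu', ← hv']
    by_cases huA : u ∈ A
    · by_cases hvA : v ∈ A
      · by_cases huv : u = v
        · subst huv
          simp [huA, realEntry, h0]
        · simp [huA, hvA, huv, realEntry, h0 huA]
      · have huv : u ≠ v := fun h => hvA (h ▸ huA)
        simp [huA, hvA, huv, realEntry, h0 huA]
    · simp [huA, realEntry, hk']
  have hsub : A ⊆ T := Finset.filter_subset _ _
  have h₂ : inner G.realEntry T = inner G.realEntry (T.filter (· < G.n)) := by
    unfold inner
    rw [Finset.sum_filter]
    refine Finset.sum_congr rfl fun u _ => ?_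
    rw [Finset.sum_filter]
    by_cases hu : u < G.n
    · rw [if_pos hu]
      refine Finset.sum_congr rfl fun v _ => ?_
      by_cases hv : v < G.n
      · rw [if_pos hv]
      · rw [if_neg hv, realEntry, entry, dif_neg fun h => hv h.2, Nat.cast_zero]
    · rw [if_neg hu]
      refine Finset.sum_eq_zero fun v _ => ?_
      rw [realEntry, entry, dif_neg fun h => hu h.1, Nat.cast_zero]
  have h₃ : ∑ u ∈ T, ∑ v ∈ T, (if u ∈ A then (if v ∈ A then (G.rowSum : ℝ) else 0) else 0) =
      G.rowSum * ((A.card : ℝ) * A.card) := by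
    have : ∀ u ∈ T, ∑ v ∈ T, (if u ∈ A then (if v ∈ A then (G.rowSum : ℝ) else 0) else 0) =
        if u ∈ A then A.card * (G.rowSum : ℝ) else 0 := by
      intro u _
      split
      · rw [Finset.sum_ite_mem, Finset.inter_eq_right.2 hsub, Finset.sum_const, nsmul_eq_mul]
      · exact Finset.sum_const_zero
    rw [Finset.sum_congr rfl this, Finset.sum_ite_mem, Finset.inter_eq_right.2 hsub,
      Finset.sum_const, nsmul_eq_mul]
    ring
  have h₄ : ∑ u ∈ T, ∑ v ∈ T, (if u ∈ A then (if u = v then (G.rowSum : ℝ) else 0) else 0) =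
      G.rowSum * (A.card : ℝ) := by
    have : ∀ u ∈ T, ∑ v ∈ T, (if u ∈ A then (if u = v then (G.rowSum : ℝ) else 0) else 0) =
        if u ∈ A then (G.rowSum : ℝ) else 0 := by
      intro u hu
      split
      · rw [Finset.sum_ite_eq, if_pos hu]
      · exact Finset.sum_const_zero
    rw [Finset.sum_congr rfl this, Finset.sum_ite_mem, Finset.inter_eq_right.2 hsub,
      Finset.sum_const, nsmul_eq_mul]
    ring
  rw [inner, Finset.sum_congr rfl fun u hu => Finset.sum_congr rfl fun v hv => h₁ u hu v hv,
    ← h₂]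
  simp only [Finset.sum_add_distrib, Finset.sum_sub_distrib, ← Finset.mul_sum, h₃, h₄]
  rw [inner]
  ring

theorem density_out (G : WGraph) (k : ℕ) (T : Finset (Fin (G.out k).n)) :
    (G.out k).density T =
      inner (fun u v => (G.outNum k u v : ℝ)) (T.map Fin.valEmbedding) / T.card := by
  rw [density, inner_map_val]
  simp [weight, out]

theorem map_val_filter {m : ℕ} (T : Finset (Fin m)) (p : ℕ → Prop) [DecidablePred p] :
    ((T.map Fin.valEmbedding).filter p).card = (T.filter fun v : Fin m => p v).card := by
  rw [Finset.filter_map, Finset.card_map]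
  rfl

/-- A fair set of the constructed graph has as many old as new vertices. -/
theorem fairSet_out_iff (G : WGraph) (k : ℕ) (T : Finset (Fin (G.out k).n)) :
    (G.out k).FairSet (G.outRed k) T ↔
      ((T.map Fin.valEmbedding).filter (G.n ≤ ·)).card =
        ((T.map Fin.valEmbedding).filter (· < G.n)).card := by
  rw [map_val_filter, map_val_filter, FairSet]
  simp only [outRed, decide_eq_true_eq, decide_eq_false_iff_not, not_le]

theorem card_filter_le_add_lt (T : Finset ℕ) (n : ℕ) :
    (T.filter (n ≤ ·)).card + (T.filter (· < n)).card = T.card := by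
  have := Finset.card_filter_add_card_filter_not (s := T) (n ≤ ·)
  simpa only [not_le] using this

theorem exists_map_val_eq {m : ℕ} {T : Finset ℕ} (hT : T ⊆ Finset.range m) :
    ∃ S : Finset (Fin m), S.map Fin.valEmbedding = T := by
  refine ⟨T.attachFin fun i hi => Finset.mem_range.1 (hT hi), ?_⟩
  ext i
  simp only [Finset.mem_map, Finset.mem_attachFin, Fin.valEmbedding_apply]
  exact ⟨fun ⟨a, ha, h⟩ => h ▸ ha, fun h => ⟨⟨i, Finset.mem_range.1 (hT h)⟩, h, rfl⟩⟩

theorem fairSet_out_univ (G : WGraph) (k : ℕ) :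
    (G.out k).FairSet (G.outRed k) Finset.univ := by
  rw [fairSet_out_iff]
  have h : (Finset.univ : Finset (Fin (G.out k).n)).map Fin.valEmbedding =
      Finset.range (G.n + G.n) := by
    rw [Fin.map_valEmbedding_univ, Nat.Iio_eq_range]
    rfl
  have h₁ := card_filter_le_add_lt (Finset.range (G.n + G.n)) G.n
  have h₂ : (Finset.range (G.n + G.n)).filter (· < G.n) = Finset.range G.n := by
    ext i
    simp only [Finset.mem_filter, Finset.mem_range]
    omega
  rw [h]
  rw [h₂, Finset.card_range, Finset.card_range] at h₁
  rw [h₂, Finset.card_range]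
  omega

/-- If all sets of size `k` expand, then all fair sets of the constructed graph are sparse. -/
theorem inner_out_le {G : WGraph} {d η : ℝ} (hG : G.IsRegular d) (hd : 0 < d) (hn : 0 < G.n)
    (hη : 0 ≤ η) {k : ℕ} (hk : 1 ≤ k) (hkn : k ≤ G.n)
    (hno : ∀ S : Finset (Fin G.n), S.card = k → 1 - η ≤ G.expansion d S)
    {T : Finset (Fin (G.out k).n)} (hT : (G.out k).FairSet (G.outRed k) T) :
    2 * inner (fun u v => (G.outNum k u v : ℝ)) (T.map Fin.valEmbedding) ≤
      (1 + 2 * η) * (G.rowSum * (((k : ℝ) - 1) * T.card)) := by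
  have hden : (0 : ℝ) < G.den := by exact_mod_cast G.den_pos
  rw [fairSet_out_iff] at hT
  have hcard := card_filter_le_add_lt (T.map Fin.valEmbedding) G.n
  rw [hT, Finset.card_map] at hcard
  rw [inner_outNum G hk]
  set T' := T.map Fin.valEmbedding
  have hA : (T'.filter fun u => G.n ≤ u ∧ u < G.n + k).card ≤ k := by
    have : T'.filter (fun u => G.n ≤ u ∧ u < G.n + k) ⊆ Finset.Ico G.n (G.n + k) := by
      intro u hu
      rw [Finset.mem_filter] at hu
      exact Finset.mem_Ico.2 hu.2
    simpa using Finset.card_le_card this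
  -- The red vertices outside the clique are isolated. They only fill up the number of red vertices,
  -- so those in the clique are at most as many as the blue ones.
  have hA' : (T'.filter fun u => G.n ≤ u ∧ u < G.n + k).card ≤ (T'.filter (· < G.n)).card := by
    rw [← hT]
    exact Finset.card_le_card (Finset.monotone_filter_right _ fun u _ hu => hu.1)
  have := inner_add_clique_le (w := G.realEntry) G.realEntry_nonneg G.realEntry_comm
    G.realEntry_self (R := Finset.range G.n) (D := G.den * d) (η := η) (by positivity) hη
    (fun u hu => sum_realEntry hG hu) hk (by simpa using hkn)
    (by
      intro S hS hc
      obtain ⟨S, rfl⟩ := exists_map_val_eq hS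
      rw [Finset.card_map] at hc
      have h := hno S hc
      have hk' : (0 : ℝ) < k := by exact_mod_cast hk
      rw [expansion_eq hG hd (Finset.card_pos.1 (by omega)), hc, sub_le_sub_iff_left,
        div_le_iff₀ (by positivity)] at h
      linarith)
    (S := T'.filter (· < G.n)) (fun u hu => Finset.mem_range.2 (Finset.mem_filter.1 hu).2) hA hA'
  rw [← rowSum_eq hG hn] at this
  have hc' : (T.card : ℝ) = 2 * (T'.filter (· < G.n)).card := by
    rw [← hcard]; push_cast; ring
  rw [hc']
  linarith

/-- A set of size `k` that does not expand gives rise to a dense fair set. -/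
theorem exists_density_out_ge {G : WGraph} {d η : ℝ} (hG : G.IsRegular d) (hd : 0 < d)
    (hn : 0 < G.n) {k : ℕ} (hk : 1 ≤ k) {S : Finset (Fin G.n)} (hS : S.card = k)
    (hη : G.expansion d S ≤ η) :
    ∃ T : Finset (Fin (G.out k).n), T.Nonempty ∧ (G.out k).FairSet (G.outRed k) T ∧
      (1 - η / 2) * (G.rowSum * ((k : ℝ) - 1)) ≤ (G.out k).density T := by
  have hden : (0 : ℝ) < G.den := by exact_mod_cast G.den_pos
  have hk' : (1 : ℝ) ≤ k := by exact_mod_cast hk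
  have hkn : k ≤ G.n := by simpa [hS] using Finset.card_le_univ S
  set S' := S.map Fin.valEmbedding with hS'
  have hSlt : ∀ u ∈ S', u < G.n := by
    intro u hu
    obtain ⟨v, -, rfl⟩ := Finset.mem_map.1 hu
    exact v.2
  have hdisj : Disjoint S' (Finset.Ico G.n (G.n + k)) := by
    rw [Finset.disjoint_left]
    intro u hu hu'
    have := hSlt u hu
    rw [Finset.mem_Ico] at hu'
    omega
  -- The dense fair set is S together with the whole clique.
  obtain ⟨T, hT⟩ := exists_map_val_eq (m := (G.out k).n)
    (T := S' ∪ Finset.Ico G.n (G.n + k)) (by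
      intro u hu
      change u ∈ Finset.range (G.n + G.n)
      rw [Finset.mem_range]
      rcases Finset.mem_union.1 hu with h | h
      · have := hSlt u h
        omega
      · rw [Finset.mem_Ico] at h
        omega)
  have hB : (S' ∪ Finset.Ico G.n (G.n + k)).filter (· < G.n) = S' := by
    ext u
    simp only [Finset.mem_filter, Finset.mem_union, Finset.mem_Ico]
    have := hSlt u
    constructor
    · rintro ⟨h | h, h'⟩
      · exact h
      · omega
    · exact fun h => ⟨Or.inl h, this h⟩
  -- Two filters are covered at once: being red and lying in the clique, which agree on this set.
  have hA : ∀ (p : ℕ → Prop) [DecidablePred p], (∀ u, p u → G.n ≤ u) →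
      (∀ u, G.n ≤ u → u < G.n + k → p u) →
      (S' ∪ Finset.Ico G.n (G.n + k)).filter p = Finset.Ico G.n (G.n + k) := by
    intro p _ hp hp'
    ext u
    simp only [Finset.mem_filter, Finset.mem_union, Finset.mem_Ico]
    constructor
    · rintro ⟨h | h, h'⟩
      · have := hSlt u h
        have := hp u h'
        omega
      · exact h
    · exact fun h => ⟨Or.inr h, hp' u h.1 h.2⟩
  have hcS : S'.card = k := by rw [hS', Finset.card_map, hS]
  have hcT : T.card = k + k := by
    rw [← Finset.card_map Fin.valEmbedding, hT, Finset.card_union_of_disjoint hdisj, hcS]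
    simp
  refine ⟨T, Finset.card_pos.1 (by omega), ?_, ?_⟩
  · rw [fairSet_out_iff, hT, hB, hA _ (fun _ h => h) (fun _ h _ => h), hcS]
    simp
  · rw [density_out, hT, inner_outNum G hk, hB,
      hA _ (fun _ h => h.1) (fun _ h h' => ⟨h, h'⟩), hcT]
    rw [expansion_eq hG hd (Finset.card_pos.1 (by omega)), hS, ← rowSum_eq hG hn] at hη
    have hD : (0 : ℝ) < G.rowSum := by rw [rowSum_eq hG hn]; positivity
    have h₁ : (1 - η) * (G.rowSum * k) ≤ inner G.realEntry S' := by
      have : 1 - η ≤ inner G.realEntry S' / (G.rowSum * k) := by linarith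
      rwa [le_div_iff₀ (by positivity)] at this
    have h₂ := mul_le_mul_of_nonneg_left h₁ (by linarith : (0 : ℝ) ≤ (k : ℝ) - 1)
    rw [le_div_iff₀ (by push_cast; linarith), Nat.card_Ico, Nat.add_sub_cancel_left]
    push_cast
    nlinarith

/-! ### Sets given by their indicator vector -/

theorem isOne_encodeSet (G : WGraph) (S : Finset (Fin G.n)) (u : ℕ) :
    isOne (encodeSet G S)[u]? = true ↔ u ∈ S.map Fin.valEmbedding := by
  rw [encodeSet, List.getElem?_ofFn]
  by_cases h : u < G.n
  · rw [dif_pos h, isOne_bit, decide_eq_true_eq]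
    simp only [Finset.mem_map, Fin.valEmbedding_apply]
    exact ⟨fun h' => ⟨_, h', rfl⟩, fun ⟨v, hv, h'⟩ => by subst h'; exact hv⟩
  · rw [dif_neg h]
    refine ⟨fun h' => by simp [isOne] at h', fun h' => ?_⟩
    obtain ⟨v, -, rfl⟩ := Finset.mem_map.1 h'
    exact absurd v.2 h

theorem map_val_subset_range {m : ℕ} (S : Finset (Fin m)) :
    S.map Fin.valEmbedding ⊆ Finset.range m := by
  intro u hu
  obtain ⟨v, -, rfl⟩ := Finset.mem_map.1 hu
  exact Finset.mem_range.2 v.2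

theorem wordCard_encodeSet (G : WGraph) (S : Finset (Fin G.n)) :
    wordCard G.n (encodeSet G S) = S.card := by
  rw [wordCard, ← Finset.card_map Fin.valEmbedding]
  simp only [isOne_encodeSet, Finset.filter_mem_eq_inter]
  rw [Finset.inter_eq_right.2 (map_val_subset_range S)]

theorem wordWeight_encodeSet (G : WGraph) (k : ℕ) (S : Finset (Fin (G.out k).n)) :
    (G.wordWeight k (encodeSet (G.out k) S) : ℝ) =
      inner (fun u v => (G.outNum k u v : ℝ)) (S.map Fin.valEmbedding) := by
  have hS := map_val_subset_range S
  change _ ⊆ Finset.range (G.n + G.n) at hS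
  rw [wordWeight, inner, Nat.cast_sum, ← Finset.inter_eq_right.2 hS, ← Finset.sum_ite_mem,
    Finset.inter_eq_right.2 hS]
  refine Finset.sum_congr rfl fun u _ => ?_
  simp only [Bool.and_eq_true, isOne_encodeSet]
  by_cases hu : u ∈ S.map Fin.valEmbedding
  · simp only [hu, true_and, if_true]
    rw [← Finset.sum_filter, Finset.filter_mem_eq_inter, Finset.inter_eq_right.2 hS, Nat.cast_sum]
  · simp [hu]

/-- With η = 1/N, the integer test is the inequality "density > (1 + 2η)/2 times the degree",
cleared of denominators by the factor N. -/
theorem isDense_encodeSet_iff (G : WGraph) {N k : ℕ} (hN : 0 < N) (hk : 1 ≤ k)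
    (S : Finset (Fin (G.out k).n)) :
    G.isDense N k (encodeSet (G.out k) S) = true ↔
      (1 + 2 * (1 / (N : ℝ))) * (G.rowSum * (((k : ℝ) - 1) * S.card)) <
        2 * inner (fun u v => (G.outNum k u v : ℝ)) (S.map Fin.valEmbedding) := by
  have hN' : (0 : ℝ) < N := by exact_mod_cast hN
  have h := wordCard_encodeSet (G.out k) S
  change wordCard (G.n + G.n) _ = _ at h
  rw [isDense, decide_eq_true_eq, h, ← wordWeight_encodeSet, ← Nat.cast_lt (α := ℝ)]
  push_cast [Nat.cast_sub hk]
  have h₁ : (N : ℝ) * ((1 + 2 * (1 / (N : ℝ))) * (G.rowSum * (((k : ℝ) - 1) * S.card))) =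
      (N + 2) * (S.card * (((k : ℝ) - 1) * G.rowSum)) := by
    field_simp
  rw [← mul_lt_mul_iff_right₀ hN' (b := (1 + 2 * (1 / (N : ℝ))) * _), h₁,
    show (N : ℝ) * (2 * (G.wordWeight k (encodeSet (G.out k) S) : ℝ)) =
    2 * N * G.wordWeight k (encodeSet (G.out k) S) by ring]

/-- Every nonempty fair graph has a fair set of greatest density. -/
theorem exists_densest (G : WGraph) (red : Fin G.n → Bool) (hn : 0 < G.n)
    (h : G.FairSet red Finset.univ) : ∃ S : Finset (Fin G.n), S.Nonempty ∧ G.FairSet red S ∧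
      ∀ T : Finset (Fin G.n), T.Nonempty → G.FairSet red T → G.density T ≤ G.density S := by
  classical
  obtain ⟨S, hS, hmax⟩ := Finset.exists_max_image
    (Finset.univ.filter fun S : Finset (Fin G.n) => S.Nonempty ∧ G.FairSet red S)
    (fun S => G.density S)
    ⟨Finset.univ, by simp only [Finset.mem_filter, Finset.mem_univ, true_and]; exact
      ⟨⟨⟨0, hn⟩, Finset.mem_univ _⟩, h⟩⟩
  simp only [Finset.mem_filter, Finset.mem_univ, true_and] at hS hmax
  exact ⟨S, hS.1, hS.2, fun T h₁ h₂ => hmax T ⟨h₁, h₂⟩⟩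

theorem density_nonneg (G : WGraph) (S : Finset (Fin G.n)) : 0 ≤ G.density S :=
  div_nonneg (Finset.sum_nonneg fun _ _ => Finset.sum_nonneg fun _ _ =>
    div_nonneg (Nat.cast_nonneg _) (Nat.cast_nonneg _)) (Nat.cast_nonneg _)

end WGraph

/-! ### Unique readability of coloured graphs -/

/-- The comparison algorithm sees only the words. If they coincide, its verdicts are those of a
number against itself, so neither number is smaller. -/
theorem bitsWord_injective : Function.Injective bitsWord := by
  intro m n h
  have h₁ := ltWord_bitsWord m n false
  have h₂ := ltWord_bitsWord n m false
  rw [h, ltWord_bitsWord, decide_eq_decide] at h₁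
  rw [h, ltWord_bitsWord, decide_eq_decide] at h₂
  simp only [Bool.false_eq_true, and_false, or_false, lt_irrefl, false_iff] at h₁ h₂
  omega

theorem sep_notMem_colors {n : ℕ} (red : Fin n → Bool) :
    Sym.sep ∉ List.ofFn fun v => bit (red v) := by
  rw [List.mem_ofFn]
  rintro ⟨v, hv⟩
  cases h : red v <;> simp [bit, h] at hv

theorem bit_injective : Function.Injective bit := by
  intro a b h
  cases a <;> cases b <;> simp [bit] at h ⊢

/-- `FairDensestApprox` asks only for some graph encoded by the instance; uniqueness makes an answer
speak about the graph that was constructed. The colour list determines n, and the numbers after it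
determine the weights. -/
theorem encodeColored_injective {G G' : WGraph} {red : Fin G.n → Bool} {red' : Fin G'.n → Bool}
    (h : encodeColored G red = encodeColored G' red') :
    (⟨G, red⟩ : (G : WGraph) × (Fin G.n → Bool)) = ⟨G', red'⟩ := by
  rw [encodeColored, encodeColored, List.append_assoc, List.append_assoc, List.singleton_append,
    List.singleton_append] at h
  have h₁ := congrArg takeNum h
  have h₂ := congrArg dropNum h
  rw [takeNum_append (sep_notMem_colors red), takeNum_append (sep_notMem_colors red')] at h₁
  rw [dropNum_append (sep_notMem_colors red), dropNum_append (sep_notMem_colors red'),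
    encodeWeights_eq, encodeWeights_eq] at h₂
  have hn : G.n = G'.n := by simpa using congrArg List.length h₁
  have h₃ : ∀ i, G.stream.getD i 0 = G'.stream.getD i 0 := by
    intro i
    apply bitsWord_injective
    rw [← takeNum_iterate_dropNum, h₂, takeNum_iterate_dropNum]
  have hden : G.den = G'.den := h₃ 0
  have hentry : ∀ u v, u < G.n → v < G.n → G.entry u v = G'.entry u v := by
    intro u v hu hv
    rw [← stream_getD G hu hv, h₃, hn, stream_getD G' (hn ▸ hu) (hn ▸ hv)]
  obtain ⟨n, num, den, _, _, _⟩ := G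
  obtain ⟨n', num', den', _, _, _⟩ := G'
  dsimp only at hn hden hentry red red'
  subst hn hden
  have hnum : num = num' := by
    funext u v
    have := hentry u v u.2 v.2
    simpa [entry] using this
  subst hnum
  have hred : red = red' := by
    funext v
    exact bit_injective (congrFun (List.ofFn_injective h₁) v)
  rw [hred]

/-! ### The hardness of the fair densest subgraph problem -/

/-- The constructed instances are admissible. -/
theorem exists_fairDensestApprox (G : WGraph) (hn : 0 < G.n) (k : ℕ) {c : ℝ} (hc : 1 ≤ c) :
    ∃ y, FairDensestApprox c (encodeColored (G.out k) (G.outRed k)) y := by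
  obtain ⟨S, hS, hf, hmax⟩ := exists_densest (G.out k) (G.outRed k) (Nat.add_pos_left hn _)
    (fairSet_out_univ G k)
  refine ⟨_, G.out k, G.outRed k, S, rfl, fairSet_out_univ G k, rfl, hS, hf, fun T h₁ h₂ => ?_⟩
  exact (hmax T h₁ h₂).trans (le_mul_of_one_le_left (density_nonneg _ _) hc)

/-- In a graph without expansion of some `k`-set, all approximate solutions are dense. -/
theorem isDense_of_expansion_le {G : WGraph} {d ε : ℝ} {N k : ℕ} (hG : G.IsRegular d) (hd : 0 < d)
    (hn : 0 < G.n) (hk : 1 ≤ k) (hN : 2 ≤ N) (hNε : 5 / ε < N) (hε : 0 < ε) (hε1 : ε ≤ 1)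
    {S : Finset (Fin G.n)} (hS : S.card = k) (hη : G.expansion d S ≤ 1 / (N : ℝ)) {y : Word}
    (hy : FairDensestApprox (2 - ε) (encodeColored (G.out k) (G.outRed k)) y) :
    G.isDense N k y = true := by
  obtain ⟨G', red', U, hI, -, rfl, hU, -, hmax⟩ := hy
  obtain ⟨rfl, hred⟩ := Sigma.mk.inj (encodeColored_injective hI)
  obtain rfl := eq_of_heq hred
  have hN0 : (0 : ℝ) < N := by exact_mod_cast (by omega : 0 < N)
  have hN2 : (2 : ℝ) ≤ N := by exact_mod_cast hN
  -- A singleton has expansion 1, which exceeds 1/N; so k = 1 cannot occur here.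
  have hk2 : (1 : ℝ) < k := by
    rcases Nat.eq_or_lt_of_le hk with rfl | h
    · exfalso
      obtain ⟨u, rfl⟩ := Finset.card_eq_one.1 hS
      rw [expansion_eq hG hd (Finset.singleton_nonempty u), inner_map_val] at hη
      simp only [Finset.sum_singleton, realEntry_self, zero_div, sub_zero] at hη
      rw [le_div_iff₀ hN0] at hη
      linarith
    · exact_mod_cast h
  rw [isDense_encodeSet_iff G (by omega) hk]
  obtain ⟨T, hT, hTf, hdens⟩ := exists_density_out_ge hG hd hn hk hS hη
  have h := hdens.trans (hmax T hT hTf)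
  have hc : (0 : ℝ) < U.card := by exact_mod_cast hU.card_pos
  have hD : (0 : ℝ) < G.rowSum := by
    have : (0 : ℝ) < G.den := by exact_mod_cast G.den_pos
    rw [rowSum_eq hG hn]
    positivity
  rw [density_out, mul_div_assoc', le_div_iff₀ hc] at h
  set W := inner (fun u v => (G.outNum k u v : ℝ)) (U.map Fin.valEmbedding)
  obtain ⟨η, hη⟩ : ∃ η : ℝ, η = 1 / (N : ℝ) := ⟨_, rfl⟩
  rw [← hη] at h ⊢
  have hη0 : 0 < η := by rw [hη]; positivity
  have hηε : 5 * η < ε := by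
    rw [hη, mul_one_div, div_lt_iff₀ hN0]
    rwa [div_lt_iff₀ hε, mul_comm] at hNε
  have hP : 0 < G.rowSum * (((k : ℝ) - 1) * U.card) :=
    mul_pos hD (mul_pos (by linarith) hc)
  have h₁ : (2 - ε) * ((1 + 2 * η) * (G.rowSum * (((k : ℝ) - 1) * U.card))) <
      (2 - ε) * (2 * W) := by
    -- Expanded, this is 5η < ε + 2εη, which explains the choice N > 5/ε.
    have : (2 - ε) * (1 + 2 * η) < 2 * (1 - η / 2) := by nlinarith
    have := mul_lt_mul_of_pos_right this hP
    nlinarith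
  exact lt_of_mul_lt_mul_left h₁ (by linarith)

/-- In a graph where all `k`-sets expand, no solution is dense. -/
theorem isDense_eq_false_of_le_expansion {G : WGraph} {d c : ℝ} {N k : ℕ} (hG : G.IsRegular d)
    (hd : 0 < d) (hn : 0 < G.n) (hk : 1 ≤ k) (hkn : k ≤ G.n) (hN : 0 < N)
    (hno : ∀ S : Finset (Fin G.n), S.card = k → 1 - 1 / (N : ℝ) ≤ G.expansion d S) {y : Word}
    (hy : FairDensestApprox c (encodeColored (G.out k) (G.outRed k)) y) :
    G.isDense N k y = false := by
  obtain ⟨G', red', U, hI, -, rfl, -, hUf, -⟩ := hy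
  obtain ⟨rfl, hred⟩ := Sigma.mk.inj (encodeColored_injective hI)
  obtain rfl := eq_of_heq hred
  rw [← Bool.not_eq_true, isDense_encodeSet_iff G hN hk, not_lt]
  exact inner_out_le hG hd hn (by positivity) hk hkn hno hUf

end FairDensest

/-! ### The reduction from small set expansion, assembled -/

theorem theorem4 (hSSEH : FairDensest.SSEH) (ε : ℝ) (hε : 0 < ε) (hε1 : ε ≤ 1) :
    FairDensest.NPHard (FairDensest.FairDensestApprox (2 - ε)) := by
  open FairDensest in
  obtain ⟨N, hN⟩ := exists_nat_gt (5 / ε)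
  have h5 : 5 ≤ 5 / ε := by rw [le_div_iff₀ hε]; linarith
  have hN2 : 2 ≤ N := by
    have : (2 : ℝ) ≤ N := by linarith
    exact_mod_cast this
  have hN1 : (1 : ℝ) < N := by linarith
  obtain ⟨δ, hδ0, hδ1, hhard⟩ := hSSEH (1 / N) (by positivity)
    (by rw [div_lt_one (by linarith)]; exact hN1)
  obtain ⟨k, valid, hk, hvalid, hkv⟩ := exists_pT_size hδ1
  intro L hL
  obtain ⟨f, g, hf, hg, hfg⟩ := hhard L hL
  -- Every `f x` has a correct answer, so it encodes an admissible graph. The choice of `G x` need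
  -- not be effective: its encoding is the computable word `f x`.
  choose G d hfG hn hd hG hSSE using fun x => (hfg x).1.choose_spec
  have hPG : PT G := hf.pT.congr_enc (fun x => x) (fun _ => rfl) fun x => (hfG x).symm
  have hPG' : PT fun x : Word × Word => G x.1 := hPG.comp PT.fst
  have hPg := hg.pT
  -- The density test on the approximate solution recovers an answer to the expansion instance,
  -- which is then passed to `g`.
  refine ⟨fun x => encodeColored ((G x).out (k (G x).n)) ((G x).outRed (k (G x).n)),
    fun x y => if (valid (G x).n && (G x).isDense N (k (G x).n) y) = true then g x yes
      else g x no, ?_, ?_, fun x => ⟨?_, fun y hy => ?_⟩⟩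
  · exact ((PT.encodeColored_out hk).comp hPG).polyTime
  · exact PT.polyTime₂ (((hvalid.comp (PT.vertices.comp hPG')).bool₂ (fun a b => a && b)
      ((PT.isDense N hk).comp (hPG'.pair PT.snd))).ite
        (hPg.comp (PT.fst.pair (PT.const yes))) (hPg.comp (PT.fst.pair (PT.const no))))
  · exact exists_fairDensestApprox (G x) (hn x) _ (by linarith)
  · dsimp only at hy ⊢
    have hn' : (0 : ℝ) < (G x).n := by exact_mod_cast hn x
    obtain ⟨hv, hv'⟩ := hkv (G x).n (hn x)
    have hno : (∀ S : Finset (Fin (G x).n), (S.card : ℝ) = δ * ((G x).n : ℝ) →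
        1 - 1 / (N : ℝ) ≤ (G x).expansion (d x) S) → (g x no = yes ↔ x ∈ L) := fun h =>
      (hfg x).2 no ⟨G x, d x, hfG x, hn x, hd x, hG x, Or.inr ⟨rfl, h⟩⟩
    -- If δn is not an integer, no set has the required size and "no" is vacuously correct, whatever
    -- the constructed graph looks like.
    cases hval : valid (G x).n with
    | false =>
      simp only [Bool.false_and, Bool.false_eq_true, if_false]
      exact hno fun S hS => absurd hS (hv' hval _)
    | true =>
      have hkδ := hv hval
      have hk1 : 1 ≤ k (G x).n := by
        have : (0 : ℝ) < k (G x).n := by rw [hkδ]; positivity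
        exact_mod_cast this
      have hkn : k (G x).n ≤ (G x).n := by
        have : (k (G x).n : ℝ) ≤ (G x).n := by rw [hkδ]; nlinarith
        exact_mod_cast this
      rcases hSSE x with ⟨-, S, hS, hexp⟩ | ⟨-, hall⟩
      · have hS' : S.card = k (G x).n := by
          rw [← hkδ] at hS
          exact_mod_cast hS
        rw [isDense_of_expansion_le (hG x) (hd x) (hn x) hk1 hN2 hN hε hε1 hS' hexp hy]
        simp only [Bool.and_self, if_true]
        exact (hfg x).2 yes ⟨G x, d x, hfG x, hn x, hd x, hG x, Or.inl ⟨rfl, S, hS, hexp⟩⟩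
      · rw [isDense_eq_false_of_le_expansion (hG x) (hd x) (hn x) hk1 hkn (by omega)
          (fun S hS => hall S (by rw [hS, hkδ])) hy]
        simp only [Bool.and_false, Bool.false_eq_true, if_false]
        exact hno hall
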